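/- **Theorem (Selfduality of the Resolution).** Let $k$ be a field of arbitrary characteristic, let $n=2m+1$ be odd, and let $R=k[x_1,\dots,x_n]$ be graded by $\deg x_l=d_l>0$. Let $W=k^n$ with standard basis $\chi_1,\dots,\chi_n$ dual to $x_1,\dots,x_n$ and $\deg\chi_l=d_l$, and let $x_l\neg\,(w_1\wedge\dots\wedge w_i)=\sum_{j}(-1)^{j-1}x_l(w_j)\,w_1\wedge\dots\widehat{w_j}\dots\wedge w_i$. Let $M$ be a graded $R$-module of finite length, and write $M^*=\operatorname{Hom}_k(M,k)$. Assume that $M$ is Gorenstein, that is, for some $s\in\mathbb Z$ and some sign $\varepsilon=\pm1$ there is a graded isomorphism of $R$-modules $\tau:M\to M^*(-s)$ with $\tau^*(-s)=\varepsilon\tau$ (where $M=M^{**}$), i.e. $\tau(\mu')(\mu)=\varepsilon\,\tau(\mu)(\mu')$; fix such $s,\varepsilon,\tau$. Let $A_i(M)=R\otimes_k\bigwedge^iW\otimes_kM$ with $R$ acting on the left factor and with the total grading, and define $$\phi_i:A_i(M)\to A_{i-1}(M),\quad r\otimes w\otimes\mu\mapsto\sum_l x_lr\otimes(x_l\neg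 w)\otimes\mu-\sum_l r\otimes(x_l\neg w)\otimes x_l\mu,$$ and $A_0(M)\to M$, $r\otimes1\otimes\mu\mapsto r\mu$. Let $(\ )^\vee=\operatorname{Hom}_R(\ ,R\otimes_k\bigwedge^nW)(-s)$ and, for $0\le i\le n$, $$\beta_i:A_i(M)\to A_{n-i}(M)^\vee,\quad r\otimes w\otimes\mu\mapsto\bigl(r'\otimes w'\otimes\mu'\mapsto \tau(\mu)(\mu')\; r'r\otimes(w'\wedge w)\bigr).$$ Then: 1. The Nielsen complex $0\to A_n(M)\xrightarrow{\phi_n}\cdots\xrightarrow{\phi_1}A_0(M)\to M\to0$ is a graded free resolution of $M$ (by finitely generated graded free modules). 2. Every $\beta_i$ is a graded isomorphism, and $\beta_{i-1}\circ\phi_i=(-1)^{n-i}\,\phi_{n-i+1}^\vee\circ\beta_i$ for $1\le i\le n$. Consequently the Nielsen complex is isomorphic to the selfdual complex $$K(M):\ 0\to A_0(M)^\vee\xrightarrow{\phi_1^\vee}\cdots\xrightarrow{\phi_m^\vee}A_m(M)^\vee\xrightarrow{\phi_{m+1}\circ\beta_{m+1}^{-1}}A_m(M)\xrightarrow{\phi_m}\cdots\xrightarrow{\phi_1}A_0(M)\to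 M\to0.$$ 3. $K(M)$ is a graded free resolution of $M$ (by finitely generated graded free modules). 4. Let $\omega$ be any generator of the $k$-line $\bigwedge^nW$ and let $B=(b_i)$ be any homogeneous $R$-basis of $A_m(M)$. Then $A_m(M)^\vee$ has the homogeneous dual basis $B^\vee=(b_i^\vee)$, $b_i^\vee(b_j)=\delta_{ij}\,(1\otimes\omega)$, with $\deg b_i^\vee=\sum_ld_l+s-\deg b_i$, and the matrix $N=M_B^{B^\vee}(\phi_{m+1}\circ\beta_{m+1}^{-1})$ of the middle map satisfies $$N=(-1)^m\,\varepsilon\,N^t .$$ -/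

import Mathlib

open TensorProduct

namespace NielsenSelfdual

noncomputable section

/-! ### Graded modules over a weighted polynomial ring

`k` is a field, `R = k[x_1, …, x_n]` is graded by `deg x_l = d l`, and a grading of an `R`-module
`F` is a family `𝒜 : ℤ → Submodule k F`. -/

section Graded

variable {k : Type*} [Field k] {n : ℕ} (d : Fin n → ℤ)

/-- `F` is a finitely generated graded free `R`-module with respect to `𝒜`: it is the internal
direct sum of the `𝒜 j`, the action of `R` is homogeneous, and there is a finite `R`-basis made of
homogeneous elements. -/
structure IsGradedFree {F : Type*} [AddCommGroup F] [Module k F] [Module (MvPolynomial (Fin n) k) F]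
    (𝒜 : ℤ → Submodule k F) : Prop where
  isInternal : DirectSum.IsInternal 𝒜
  smul_mem : ∀ (i j : ℤ) (r : MvPolynomial (Fin n) k) (a : F),
    r ∈ MvPolynomial.weightedHomogeneousSubmodule k d i → a ∈ 𝒜 j → r • a ∈ 𝒜 (i + j)
  exists_basis : ∃ (N : ℕ) (b : Module.Basis (Fin N) (MvPolynomial (Fin n) k) F),
    ∀ t, ∃ j, b t ∈ 𝒜 j

/-- `f` is homogeneous of degree `0`. -/
def IsGradedMap {F G : Type*} [AddCommGroup F] [AddCommGroup G] [Module k F] [Module k G]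
    (𝒜 : ℤ → Submodule k F) (ℬ : ℤ → Submodule k G) (f : F → G) : Prop :=
  ∀ (j : ℤ), ∀ a ∈ 𝒜 j, f a ∈ ℬ j

/-- The grading of `Hom_R(F, D)(-s)`: the piece of degree `j` consists of the `R`-linear maps
that raise degrees by `j - s`. -/
def homGrading {F D : Type*} [AddCommGroup F] [AddCommGroup D] [Module k F] [Module k D]
    [Module (MvPolynomial (Fin n) k) F] [Module (MvPolynomial (Fin n) k) D]
    [SMulCommClass (MvPolynomial (Fin n) k) k D]
    (𝒜 : ℤ → Submodule k F) (𝒟 : ℤ → Submodule k D) (s j : ℤ) :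
    Submodule k (F →ₗ[MvPolynomial (Fin n) k] D) where
  carrier := {f | ∀ (e : ℤ), ∀ a ∈ 𝒜 e, f a ∈ 𝒟 (e + (j - s))}
  add_mem' hf hg e a ha := add_mem (hf e a ha) (hg e a ha)
  zero_mem' _ _ _ := zero_mem _
  smul_mem' c _ hf e a ha := Submodule.smul_mem _ c (hf e a ha)

end Graded

/-! ### Graded free resolutions -/

section Resolution

variable {k : Type*} [Field k] {n : ℕ} (d : Fin n → ℤ)
  {M : Type*} [AddCommGroup M] [Module k M] [Module (MvPolynomial (Fin n) k) M]
  {F : ℕ → Type*} [∀ i, AddCommGroup (F i)] [∀ i, Module k (F i)]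
  [∀ i, Module (MvPolynomial (Fin n) k) (F i)]
  {G : ℕ → Type*} [∀ i, AddCommGroup (G i)] [∀ i, Module k (G i)]
  [∀ i, Module (MvPolynomial (Fin n) k) (G i)]

/-- In `⋯ → F 1 → F 0 → M` (maps `φ i : F (i + 1) → F i` and `ε : F 0 → M`), the kernel of the map
that leaves `F i`. -/
def kerOut (φ : ∀ i, F (i + 1) →ₗ[MvPolynomial (Fin n) k] F i)
    (ε : F 0 →ₗ[MvPolynomial (Fin n) k] M) :
    ∀ i, Submodule (MvPolynomial (Fin n) k) (F i)
  | 0 => LinearMap.ker ε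
  | i + 1 => LinearMap.ker (φ i)

/-- In `0 → G 0 → G 1 → ⋯` (maps `ψ i : G i → G (i + 1)`), the image of the map that arrives
at `G i`. -/
def rangeIn (ψ : ∀ i, G i →ₗ[MvPolynomial (Fin n) k] G (i + 1)) :
    ∀ i, Submodule (MvPolynomial (Fin n) k) (G i)
  | 0 => ⊥
  | i + 1 => LinearMap.range (ψ i)

/-- `⋯ → F 1 → F 0 → M → 0` is a graded free resolution of `M`. -/
structure IsGradedFreeResolution (ℱ : ∀ i, ℤ → Submodule k (F i)) (ℳ : ℤ → Submodule k M)
    (φ : ∀ i, F (i + 1) →ₗ[MvPolynomial (Fin n) k] F i)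
    (ε : F 0 →ₗ[MvPolynomial (Fin n) k] M) : Prop where
  free : ∀ i, IsGradedFree d (ℱ i)
  graded : ∀ i, IsGradedMap (ℱ (i + 1)) (ℱ i) (φ i)
  graded_aug : IsGradedMap (ℱ 0) ℳ ε
  exact : ∀ i, LinearMap.range (φ i) = kerOut φ ε i
  surjective_aug : Function.Surjective ε

/-- The sequence `0 → G 0 → ⋯ → G m → F m → ⋯ → F 0 → M → 0`, with maps
`ψ i : G i → G (i + 1)` for `i < m`, `mid : G m → F m`, `φ i : F (i + 1) → F i` for `i < m`
and `ε : F 0 → M`, is a graded free resolution of `M` (of length `2 m + 1`). -/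
structure IsSplicedResolution (m : ℕ)
    (ℱ : ∀ i, ℤ → Submodule k (F i)) (𝒢 : ∀ i, ℤ → Submodule k (G i)) (ℳ : ℤ → Submodule k M)
    (ψ : ∀ i, G i →ₗ[MvPolynomial (Fin n) k] G (i + 1))
    (mid : G m →ₗ[MvPolynomial (Fin n) k] F m)
    (φ : ∀ i, F (i + 1) →ₗ[MvPolynomial (Fin n) k] F i)
    (ε : F 0 →ₗ[MvPolynomial (Fin n) k] M) : Prop where
  free_right : ∀ i ≤ m, IsGradedFree d (ℱ i)
  free_left : ∀ i ≤ m, IsGradedFree d (𝒢 i)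
  graded_right : ∀ i < m, IsGradedMap (ℱ (i + 1)) (ℱ i) (φ i)
  graded_left : ∀ i < m, IsGradedMap (𝒢 i) (𝒢 (i + 1)) (ψ i)
  graded_mid : IsGradedMap (𝒢 m) (ℱ m) mid
  graded_aug : IsGradedMap (ℱ 0) ℳ ε
  exact_left : ∀ i < m, LinearMap.ker (ψ i) = rangeIn ψ i
  exact_mid_left : LinearMap.ker mid = rangeIn ψ m
  exact_mid_right : LinearMap.range mid = kerOut φ ε m
  exact_right : ∀ i < m, LinearMap.range (φ i) = kerOut φ ε i
  surjective_aug : Function.Surjective ε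

end Resolution

/-! ### The `k`-dual of a graded `R`-module -/

section KDual

variable {k : Type*} [Field k] {n : ℕ} {M : Type*} [AddCommGroup M] [Module k M]
  [Module (MvPolynomial (Fin n) k) M] [IsScalarTower k (MvPolynomial (Fin n) k) M]

/-- The `R`-module structure of `Hom_k(M, k)`: `(r • f) μ = f (r • μ)`. -/
instance dualModule : Module (MvPolynomial (Fin n) k) (Module.Dual k M) where
  smul r f := f ∘ₗ Algebra.lsmul k k M r
  one_smul f := LinearMap.ext fun μ => congrArg f (one_smul _ μ)
  mul_smul r r' f := LinearMap.ext fun μ => congrArg f (by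
    change (r * r') • μ = r' • r • μ
    rw [mul_comm, mul_smul])
  smul_zero _ := rfl
  smul_add _ _ _ := rfl
  add_smul r r' f := LinearMap.ext fun μ => by
    change f ((r + r') • μ) = f (r • μ) + f (r' • μ)
    rw [add_smul, map_add]
  zero_smul f := LinearMap.ext fun μ => by
    change f ((0 : MvPolynomial (Fin n) k) • μ) = 0
    rw [zero_smul, map_zero]

theorem dual_smul_apply (r : MvPolynomial (Fin n) k) (f : Module.Dual k M) (μ : M) :
    (r • f) μ = f (r • μ) := rfl

instance dual_isScalarTower : IsScalarTower k (MvPolynomial (Fin n) k) (Module.Dual k M) where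
  smul_assoc c r f := LinearMap.ext fun μ => by
    change f ((c • r) • μ) = c • f (r • μ)
    rw [smul_assoc, map_smul]

/-- The grading of `Hom_k(M, k)`: the piece of degree `j` is `Hom_k(M_{-j}, k)`, that is, the
functionals that vanish on all `M_i` with `i ≠ -j`. -/
def dualGrading (ℳ : ℤ → Submodule k M) (j : ℤ) : Submodule k (Module.Dual k M) where
  carrier := {f | ∀ i, i ≠ -j → ∀ μ ∈ ℳ i, f μ = 0}
  add_mem' hf hg i hi μ hμ := by
    rw [LinearMap.add_apply, hf i hi μ hμ, hg i hi μ hμ, add_zero]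
  zero_mem' _ _ _ _ := rfl
  smul_mem' c f hf i hi μ hμ := by
    rw [LinearMap.smul_apply, hf i hi μ hμ, smul_zero]

/-- `τ* : M = M** → M*`, the `k`-dual of `τ : M → M*`, where `M` is identified with `M**` by
evaluation. -/
def dualOf (τ : M ≃ₗ[MvPolynomial (Fin n) k] Module.Dual k M) : M →ₗ[k] Module.Dual k M :=
  (τ.toLinearMap.restrictScalars k).dualMap ∘ₗ Module.Dual.eval k M

/-- `τ` is a graded isomorphism `M → Hom_k(M, k)(-s)` with `τ*(-s) = ε τ`, where `ε = ±1`. -/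
structure IsGorensteinIso (ℳ : ℤ → Submodule k M) (s : ℤ) (ε : ℤˣ)
    (τ : M ≃ₗ[MvPolynomial (Fin n) k] Module.Dual k M) : Prop where
  graded : ∀ (j : ℤ), ∀ μ ∈ ℳ j, τ μ ∈ dualGrading ℳ (j - s)
  dual_eq : dualOf τ = ε • τ.toLinearMap.restrictScalars k

end KDual

/-! ### Exterior powers of `W = k^n` -/

section Exterior

variable (k : Type*) [Field k] {n : ℕ}

/-- `⋀^i W`, where `W = k^n` has the standard basis `χ_1, …, χ_n`, dual to `x_1, …, x_n`. -/
abbrev Ext (n i : ℕ) : Type _ := ⋀[k]^i (Fin n → k)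

/-- The piece of degree `j` of `⋀^i W`, where `deg χ_l = d l`. -/
def extGrading (d : Fin n → ℤ) (i : ℕ) (j : ℤ) : Submodule k (Ext k n i) :=
  Submodule.span k {w | ∃ l : Fin i → Fin n, ∑ t, d (l t) = j ∧
    w = exteriorPower.ιMulti k i fun t => Pi.single (l t) (1 : k)}

variable {k}

theorem contract_mem (x : Module.Dual k (Fin n → k)) (i : ℕ) :
    ∀ w ∈ ⋀[k]^(i + 1) (Fin n → k),
      (CliffordAlgebra.contractLeft (Q := (0 : QuadraticForm k (Fin n → k))) x w :
        ExteriorAlgebra k (Fin n → k)) ∈ ⋀[k]^i (Fin n → k) := by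
  induction i with
  | zero =>
    intro w hw
    rw [zero_add, ExteriorAlgebra.exteriorPower, pow_one] at hw
    obtain ⟨v, rfl⟩ := hw
    rw [ExteriorAlgebra.exteriorPower, pow_zero]
    have h := CliffordAlgebra.contractLeft_ι (Q := (0 : QuadraticForm k (Fin n → k))) x v
    exact Submodule.mem_one.2 ⟨x v, h.symm⟩
  | succ i ih =>
    intro w hw
    rw [ExteriorAlgebra.exteriorPower, pow_succ'] at hw
    induction hw using Submodule.mul_induction_on' with
    | mem_mul_mem a ha b hb =>
      obtain ⟨v, rfl⟩ := ha
      have h := CliffordAlgebra.contractLeft_ι_mul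
        (Q := (0 : QuadraticForm k (Fin n → k))) (d := x) v b
      refine (congrArg (· ∈ ⋀[k]^(i + 1) (Fin n → k)) h).mpr (Submodule.sub_mem _ ?_ ?_)
      · exact Submodule.smul_mem _ _ hb
      · rw [ExteriorAlgebra.exteriorPower, pow_succ']
        exact Submodule.mul_mem_mul (LinearMap.mem_range_self _ v) (ih b hb)
    | add a _ b _ iha ihb =>
      rw [map_add]
      exact Submodule.add_mem _ iha ihb

/-- The contraction `w ↦ x_l ¬ w` from `⋀^(i+1) W` to `⋀^i W`,
`x_l ¬ (w_0 ∧ ⋯ ∧ w_i) = ∑ j, (-1)^j x_l(w_j) w_0 ∧ ⋯ ŵ_j ⋯ ∧ w_i`. -/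
def contract (l : Fin n) (i : ℕ) : Ext k n (i + 1) →ₗ[k] Ext k n i :=
  LinearMap.restrict (CliffordAlgebra.contractLeft (Q := (0 : QuadraticForm k (Fin n → k)))
    (LinearMap.proj l : Module.Dual k (Fin n → k))) (contract_mem _ i)

theorem mul_mem_ext {p q r : ℕ} (h : p + q = r) (a : Ext k n p) (b : Ext k n q) :
    (a : ExteriorAlgebra k (Fin n → k)) * (b : ExteriorAlgebra k (Fin n → k)) ∈
      ⋀[k]^r (Fin n → k) := by
  subst h
  rw [ExteriorAlgebra.exteriorPower, pow_add]
  exact Submodule.mul_mem_mul a.2 b.2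

/-- The exterior product `⋀^p W × ⋀^q W → ⋀^r W`, where `p + q = r`. -/
def wedge {p q r : ℕ} (h : p + q = r) : Ext k n p →ₗ[k] Ext k n q →ₗ[k] Ext k n r :=
  LinearMap.mk₂ k (fun a b => ⟨_, mul_mem_ext h a b⟩)
    (fun _ _ _ => Subtype.ext (add_mul _ _ _))
    (fun _ _ _ => Subtype.ext (smul_mul_assoc _ _ _))
    (fun _ _ _ => Subtype.ext (mul_add _ _ _))
    (fun _ _ _ => Subtype.ext (mul_smul_comm _ _ _))

end Exterior

/-! ### The Nielsen complex -/

section Nielsen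

variable (k : Type*) [Field k] (n : ℕ) (M : Type*) [AddCommGroup M] [Module k M]

/-- `A_i(M) = R ⊗_k ⋀^i W ⊗_k M`, an `R`-module by left multiplication. -/
abbrev NielsenA (i : ℕ) : Type _ := MvPolynomial (Fin n) k ⊗[k] (Ext k n i ⊗[k] M)

/-- `R ⊗_k ⋀^n W`. -/
abbrev TopModule : Type _ := MvPolynomial (Fin n) k ⊗[k] Ext k n n

/-- `A_i(M)^∨ = Hom_R(A_i(M), R ⊗_k ⋀^n W)`. -/
abbrev NielsenDual (i : ℕ) : Type _ :=
  NielsenA k n M i →ₗ[MvPolynomial (Fin n) k] TopModule k n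

variable {k n M}

/-- `A_i(M)_j = ⨁_{j₁ + j₂ + j₃ = j} R_{j₁} ⊗ (⋀^i W)_{j₂} ⊗ M_{j₃}`. -/
def nielsenGrading (d : Fin n → ℤ) (ℳ : ℤ → Submodule k M) (i : ℕ) (j : ℤ) :
    Submodule k (NielsenA k n M i) :=
  Submodule.span k {a | ∃ j₁ j₂ j₃ : ℤ, j₁ + j₂ + j₃ = j ∧
    ∃ r ∈ MvPolynomial.weightedHomogeneousSubmodule k d j₁,
    ∃ w ∈ extGrading k d i j₂, ∃ μ ∈ ℳ j₃, a = r ⊗ₜ[k] (w ⊗ₜ[k] μ)}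

/-- `(R ⊗ ⋀^n W)_j = ⨁_{j₁ + j₂ = j} R_{j₁} ⊗ (⋀^n W)_{j₂}`. -/
def topGrading (d : Fin n → ℤ) (j : ℤ) : Submodule k (TopModule k n) :=
  Submodule.span k {a | ∃ j₁ j₂ : ℤ, j₁ + j₂ = j ∧
    ∃ r ∈ MvPolynomial.weightedHomogeneousSubmodule k d j₁,
    ∃ w ∈ extGrading k d n j₂, a = r ⊗ₜ[k] w}

/-- The grading of `A_i(M)^∨ = Hom_R(A_i(M), R ⊗ ⋀^n W)(-s)`. -/
def nielsenDualGrading (d : Fin n → ℤ) (ℳ : ℤ → Submodule k M) (s : ℤ) (i : ℕ) (j : ℤ) :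
    Submodule k (NielsenDual k n M i) :=
  homGrading (nielsenGrading d ℳ i) (topGrading d) s j

variable [Module (MvPolynomial (Fin n) k) M] [IsScalarTower k (MvPolynomial (Fin n) k) M]

variable (M) in
/-- The differential `φ_{i+1} : A_{i+1}(M) → A_i(M)`. -/
def phi (i : ℕ) : NielsenA k n M (i + 1) →ₗ[MvPolynomial (Fin n) k] NielsenA k n M i :=
  ∑ l : Fin n, ((MvPolynomial.X l : MvPolynomial (Fin n) k) •
      (TensorProduct.map (contract l i) (LinearMap.id : M →ₗ[k] M)).baseChange
        (MvPolynomial (Fin n) k) -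
    (TensorProduct.map (contract l i) (Algebra.lsmul k k M (MvPolynomial.X l : MvPolynomial (Fin n) k))).baseChange
      (MvPolynomial (Fin n) k))

theorem phi_tmul (i : ℕ) (r : MvPolynomial (Fin n) k) (w : Ext k n (i + 1)) (μ : M) :
    phi M i (r ⊗ₜ[k] (w ⊗ₜ[k] μ)) =
      ∑ l, (MvPolynomial.X l * r) ⊗ₜ[k] (contract l i w ⊗ₜ[k] μ) -
      ∑ l, r ⊗ₜ[k] (contract l i w ⊗ₜ[k] ((MvPolynomial.X l : MvPolynomial (Fin n) k) • μ)) := by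
  simp [phi, LinearMap.sum_apply, TensorProduct.smul_tmul', Finset.sum_sub_distrib]

variable (k n M) in
/-- The augmentation `A_0(M) = R ⊗ k ⊗ M → M`, `r ⊗ 1 ⊗ μ ↦ r μ`. -/
def augmentation : NielsenA k n M 0 →ₗ[MvPolynomial (Fin n) k] M :=
  LinearMap.liftBaseChange (MvPolynomial (Fin n) k)
    ((TensorProduct.lid k M).toLinearMap ∘ₗ
      TensorProduct.map (exteriorPower.zeroEquiv k (Fin n → k)).toLinearMap LinearMap.id)

theorem augmentation_tmul (r : MvPolynomial (Fin n) k) (w : Ext k n 0) (μ : M) :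
    augmentation k n M (r ⊗ₜ[k] (w ⊗ₜ[k] μ)) =
      r • (exteriorPower.zeroEquiv k (Fin n → k) w • μ) := by
  simp [augmentation]

variable (M) in
/-- The dual `φ_{i+1}^∨ : A_i(M)^∨ → A_{i+1}(M)^∨` of the differential. -/
def phiDual (i : ℕ) :
    NielsenDual k n M i →ₗ[MvPolynomial (Fin n) k] NielsenDual k n M (i + 1) :=
  LinearMap.lcomp (MvPolynomial (Fin n) k) (TopModule k n) (phi M i)

/-- `β_p : A_p(M) → A_q(M)^∨`, where `q + p = n`: the element `r ⊗ w ⊗ μ` is sent to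
`r' ⊗ w' ⊗ μ' ↦ (r' r) ⊗ (w' ∧ w) ⊗ τ(μ)(μ')`. -/
def beta (τ : M ≃ₗ[MvPolynomial (Fin n) k] Module.Dual k M) {p q : ℕ} (h : q + p = n) :
    NielsenA k n M p →ₗ[MvPolynomial (Fin n) k] NielsenDual k n M q :=
  LinearMap.liftBaseChange (MvPolynomial (Fin n) k)
    (LinearMap.baseChangeHom k (MvPolynomial (Fin n) k) (Ext k n q ⊗[k] M) (Ext k n n) ∘ₗ
      (TensorProduct.map₂ (wedge h).flip (τ.toLinearMap.restrictScalars k)).compr₂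
        (TensorProduct.rid k (Ext k n n)).toLinearMap)

theorem beta_tmul (τ : M ≃ₗ[MvPolynomial (Fin n) k] Module.Dual k M) {p q : ℕ} (h : q + p = n)
    (r r' : MvPolynomial (Fin n) k) (w : Ext k n p) (w' : Ext k n q) (μ μ' : M) :
    beta τ h (r ⊗ₜ[k] (w ⊗ₜ[k] μ)) (r' ⊗ₜ[k] (w' ⊗ₜ[k] μ')) =
      (r' * r) ⊗ₜ[k] (τ μ μ' • wedge h w' w) := by
  simp [beta, TensorProduct.smul_tmul', mul_comm r r']

/-- The middle map `φ_{m+1} ∘ β_{m+1}⁻¹ : A_m(M)^∨ → A_m(M)`, where `n = 2 m + 1`. -/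
def middleMap (τ : M ≃ₗ[MvPolynomial (Fin n) k] Module.Dual k M) {m : ℕ} (h : m + (m + 1) = n)
    (hβ : Function.Bijective (beta τ h)) :
    NielsenDual k n M m →ₗ[MvPolynomial (Fin n) k] NielsenA k n M m :=
  phi M m ∘ₗ (LinearEquiv.ofBijective (beta τ h) hβ).symm.toLinearMap

end Nielsen

end

end NielsenSelfdual

/-!
The operators `x_l ⊗ 1 - 1 ⊗ x_l` on `R ⊗ M` commute, and the Nielsen complex is their Koszul
complex (`leftComm_genPhi`). It is contracted explicitly. Division of `M[x_1, …, x_n]` by `x_t ⊗ 1 -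
1 ⊗ x_t` gives a left inverse `divX` of `diffX` that commutes with the other operators `diffX`, and
`(χ_t ∧ _) ⊗ divX` is a homotopy from the identity to the tensor product of two projections, one of
which kills every monomial of `⋀ W` that contains `χ_t` (`koszul_homotopy`). Composing over all `t`
kills everything in positive degree, so the complex is exact there (`ker_koszul_le_range`,
`prod_omitProj_eq_zero`). Modulo the image of `φ_1`, the elements `r ⊗ 1 ⊗ μ` and `1 ⊗ 1 ⊗ r μ`
agree, so the cokernel of `φ_1` is `M` (`range_phi_zero`).

All gradings are handled through homogeneous bases: a graded free module carries the grading
`stdGrading` determined by the degrees of any homogeneous basis (`IsGradedFree.eq_stdGrading`), and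
the Hom into a graded free module of rank one carries the grading of the dual basis
(`homGrading_stdGrading`). The existence of `τ` forces `M` to be finite-dimensional
(`finite_of_dual_equiv`), so that `M` has a finite homogeneous basis.

The maps `β` are the base change of the tensor product of two perfect pairings, the exterior product
`⋀^q W × ⋀^p W → ⋀^n W` and `τ` (`beta_bijective`). Contraction is an antiderivation and `⋀^(n+1) W
= 0`, whence `w' ∧ (x_l ¬ w) = ± (x_l ¬ w') ∧ w` (`wedge_contract`); this is the compatibility of
`β` with the differentials (`beta_comp_phi`). Exactness of the Nielsen complex is transported
through `β` to the dual complex and to the complex spliced from the two halves (`ker_phiDual`,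
`ker_middleMap`, `range_middleMap`).

Finally, for `n = 2 m + 1`, graded commutativity of `⋀ W` introduces no sign between the degrees `m`
and `m + 1`, so the pairings `β_m` and `β_{m+1}` are adjoint up to `ε` (`beta_symm`). With
`beta_comp_phi`, the form `(f, g) ↦ f (middleMap g)` is symmetric up to `(-1)^m ε`
(`middleMap_symm`), which is the symmetry of the matrix in dual bases.
-/

namespace NielsenSelfdual

noncomputable section

/-! ### Contraction and exterior multiplication -/

section ExteriorOperators

variable {k : Type*} [Field k] {n : ℕ}

/-- The contraction by `x_l` on the whole exterior algebra. -/
def totalContract (l : Fin n) :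
    ExteriorAlgebra k (Fin n → k) →ₗ[k] ExteriorAlgebra k (Fin n → k) :=
  CliffordAlgebra.contractLeft (Q := (0 : QuadraticForm k (Fin n → k)))
    (LinearMap.proj l : Module.Dual k (Fin n → k))

theorem totalContract_ι_mul (l : Fin n) (v : Fin n → k) (b : ExteriorAlgebra k (Fin n → k)) :
    totalContract l (ExteriorAlgebra.ι k v * b) =
      v l • b - ExteriorAlgebra.ι k v * totalContract l b :=
  CliffordAlgebra.contractLeft_ι_mul (Q := (0 : QuadraticForm k (Fin n → k))) _ v b

theorem totalContract_algebraMap (l : Fin n) (c : k) :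
    totalContract l (algebraMap k (ExteriorAlgebra k (Fin n → k)) c) = 0 :=
  CliffordAlgebra.contractLeft_algebraMap (Q := (0 : QuadraticForm k (Fin n → k))) _ c

theorem totalContract_comm (l l' : Fin n) (b : ExteriorAlgebra k (Fin n → k)) :
    totalContract l (totalContract l' b) = -totalContract l' (totalContract l b) :=
  CliffordAlgebra.contractLeft_comm (Q := (0 : QuadraticForm k (Fin n → k))) _ _ b

theorem totalContract_self (l : Fin n) (b : ExteriorAlgebra k (Fin n → k)) :
    totalContract l (totalContract l b) = 0 :=
  CliffordAlgebra.contractLeft_contractLeft (Q := (0 : QuadraticForm k (Fin n → k))) _ b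

theorem totalContract_zero_ext (l : Fin n) (w : Ext k n 0) :
    totalContract l (w : ExteriorAlgebra k (Fin n → k)) = 0 := by
  obtain ⟨w, hw⟩ := w
  rw [ExteriorAlgebra.exteriorPower, pow_zero] at hw
  obtain ⟨c, rfl⟩ := Submodule.mem_one.1 hw
  exact totalContract_algebraMap l c

/-- The Leibniz rule for contractions. -/
theorem totalContract_mul (l : Fin n) {p : ℕ} {a : ExteriorAlgebra k (Fin n → k)}
    (ha : a ∈ ⋀[k]^p (Fin n → k)) (b : ExteriorAlgebra k (Fin n → k)) :
    totalContract l (a * b) = totalContract l a * b + (-1 : k) ^ p • (a * totalContract l b) := by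
  refine Submodule.pow_induction_on_left' (M := LinearMap.range (ExteriorAlgebra.ι k))
    (C := fun p a _ => totalContract l (a * b) =
      totalContract l a * b + (-1 : k) ^ p • (a * totalContract l b)) ?_ ?_ ?_ ha
  · intro c
    simp [← Algebra.smul_def, totalContract_algebraMap]
  · intro x y i _ _ hx hy
    simp only [add_mul, map_add, hx, hy, smul_add]
    abel
  · rintro _ ⟨v, rfl⟩ i x _ ih
    rw [mul_assoc, totalContract_ι_mul, totalContract_ι_mul, ih, sub_mul, mul_add, mul_smul_comm,
      pow_succ, mul_neg_one, neg_smul, smul_mul_assoc, mul_assoc, mul_assoc]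
    abel

theorem ι_mul_ι_comm (v w : Fin n → k) :
    ExteriorAlgebra.ι k v * ExteriorAlgebra.ι k w =
      -(ExteriorAlgebra.ι k w * ExteriorAlgebra.ι k v) :=
  eq_neg_of_add_eq_zero_left (ExteriorAlgebra.ι_add_mul_swap v w)

theorem mul_ι_comm (v : Fin n → k) {q : ℕ} {b : ExteriorAlgebra k (Fin n → k)}
    (hb : b ∈ ⋀[k]^q (Fin n → k)) :
    b * ExteriorAlgebra.ι k v = (-1 : k) ^ q • (ExteriorAlgebra.ι k v * b) := by
  refine Submodule.pow_induction_on_left' (M := LinearMap.range (ExteriorAlgebra.ι k))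
    (C := fun q b _ => b * ExteriorAlgebra.ι k v = (-1 : k) ^ q • (ExteriorAlgebra.ι k v * b))
    ?_ ?_ ?_ hb
  · intro c
    simp [Algebra.commutes]
  · intro x y i _ _ hx hy
    simp only [add_mul, mul_add, hx, hy, smul_add]
  · rintro _ ⟨w, rfl⟩ i x _ ih
    rw [mul_assoc, ih, mul_smul_comm, ← mul_assoc, ι_mul_ι_comm, pow_succ, mul_neg_one, neg_smul,
      neg_mul, smul_neg, mul_assoc]

/-- Graded commutativity of the exterior algebra. -/
theorem mul_comm_ext {p q : ℕ} {a b : ExteriorAlgebra k (Fin n → k)}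
    (ha : a ∈ ⋀[k]^p (Fin n → k)) (hb : b ∈ ⋀[k]^q (Fin n → k)) :
    b * a = (-1 : k) ^ (p * q) • (a * b) := by
  refine Submodule.pow_induction_on_left' (M := LinearMap.range (ExteriorAlgebra.ι k))
    (C := fun p a _ => b * a = (-1 : k) ^ (p * q) • (a * b)) ?_ ?_ ?_ ha
  · intro c
    simp [Algebra.commutes]
  · intro x y i _ _ hx hy
    simp only [add_mul, mul_add, hx, hy, smul_add]
  · rintro _ ⟨w, rfl⟩ i x _ ih
    rw [← mul_assoc, mul_ι_comm w hb, smul_mul_assoc, mul_assoc, ih, mul_smul_comm, smul_smul,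
      mul_assoc, Nat.succ_mul, pow_add, mul_comm]

/-- Exterior multiplication `w ↦ χ_l ∧ w` from `⋀^i W` to `⋀^(i+1) W`. -/
def leftMul (l : Fin n) (i : ℕ) : Ext k n i →ₗ[k] Ext k n (i + 1) :=
  LinearMap.restrict (LinearMap.mulLeft k (ExteriorAlgebra.ι k (Pi.single l (1 : k))))
    fun w hw => by
      rw [ExteriorAlgebra.exteriorPower, pow_succ']
      exact Submodule.mul_mem_mul (LinearMap.mem_range_self _ _) hw

theorem coe_leftMul (l : Fin n) (i : ℕ) (w : Ext k n i) :
    (leftMul l i w : ExteriorAlgebra k (Fin n → k)) =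
      ExteriorAlgebra.ι k (Pi.single l (1 : k)) *
        (w : ExteriorAlgebra k (Fin n → k)) := rfl

theorem contract_comp_contract (l l' : Fin n) (i : ℕ) :
    contract (k := k) l i ∘ₗ contract (k := k) l' (i + 1) =
      -(contract (k := k) l' i ∘ₗ contract (k := k) l (i + 1)) :=
  LinearMap.ext fun w => Subtype.ext <|
    totalContract_comm l l' (w : ExteriorAlgebra k (Fin n → k))

theorem contract_comp_contract_self (l : Fin n) (i : ℕ) :
    contract (k := k) l i ∘ₗ contract (k := k) l (i + 1) = 0 :=
  LinearMap.ext fun w => Subtype.ext <|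
    totalContract_self l (w : ExteriorAlgebra k (Fin n → k))

theorem contract_comp_leftMul_ne {l t : Fin n} (h : l ≠ t) (i : ℕ) :
    contract (k := k) l (i + 1) ∘ₗ leftMul (k := k) t (i + 1) =
      -(leftMul (k := k) t i ∘ₗ contract (k := k) l i) := by
  refine LinearMap.ext fun w => Subtype.ext ?_
  change totalContract l (ExteriorAlgebra.ι k (Pi.single t (1 : k)) *
      (w : ExteriorAlgebra k (Fin n → k))) =
    -(ExteriorAlgebra.ι k (Pi.single t (1 : k)) *
      totalContract l (w : ExteriorAlgebra k (Fin n → k)))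
  rw [totalContract_ι_mul, Pi.single_eq_of_ne h, zero_smul, zero_sub]

/-- The operator `w ↦ x_t ¬ (χ_t ∧ w)` of `⋀^i W`. It is the projection onto the span of the
monomials without `χ_t` that kills all the monomials with `χ_t`. -/
def omitProj (t : Fin n) (i : ℕ) : Module.End k (Ext k n i) := contract t i ∘ₗ leftMul t i

theorem leftMul_comp_contract (t : Fin n) (i : ℕ) :
    leftMul (k := k) t i ∘ₗ contract (k := k) t i = LinearMap.id - omitProj t (i + 1) := by
  refine LinearMap.ext fun w => Subtype.ext ?_
  change ExteriorAlgebra.ι k (Pi.single t (1 : k)) * totalContract t (w : ExteriorAlgebra k _) =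
    (w : ExteriorAlgebra k _) -
    totalContract t (ExteriorAlgebra.ι k (Pi.single t (1 : k)) *
      (w : ExteriorAlgebra k (Fin n → k)))
  rw [totalContract_ι_mul, Pi.single_eq_same, one_smul, sub_sub_cancel]

/-- The monomial `χ_{l_0} ∧ ⋯ ∧ χ_{l_{i-1}}`. -/
def extMonomial (k : Type*) [Field k] {n i : ℕ} (l : Fin i → Fin n) : Ext k n i :=
  exteriorPower.ιMulti k i fun t => Pi.single (l t) (1 : k)

theorem extMonomial_succ {i : ℕ} (l : Fin (i + 1) → Fin n) :
    extMonomial k l = leftMul (l 0) i (extMonomial k (Fin.tail l)) :=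
  Subtype.ext (ExteriorAlgebra.ιMulti_succ_apply _)

theorem leftMul_extMonomial {i : ℕ} (t : Fin n) (l : Fin i → Fin n) :
    leftMul t i (extMonomial k l) = extMonomial k (Fin.cons t l) := by
  rw [extMonomial_succ, Fin.cons_zero, Fin.tail_cons]

theorem extMonomial_eq_zero {i : ℕ} {l : Fin i → Fin n} (hl : ¬ Function.Injective l) :
    extMonomial k l = 0 := by
  refine AlternatingMap.map_eq_zero_of_not_injective _ _ fun h => hl fun a b hab => h ?_
  simp only [hab]

theorem totalContract_extMonomial {i : ℕ} {t : Fin n} {l : Fin i → Fin n} (h : ∀ j, l j ≠ t) :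
    totalContract t (extMonomial k l : ExteriorAlgebra k (Fin n → k)) = 0 := by
  induction i with
  | zero => exact totalContract_zero_ext t _
  | succ i ih =>
    rw [extMonomial_succ, coe_leftMul, totalContract_ι_mul, ih (l := Fin.tail l) fun j => h _,
      Pi.single_eq_of_ne (h 0).symm, zero_smul, mul_zero, sub_zero]

theorem omitProj_extMonomial_of_mem {i : ℕ} {t : Fin n} {l : Fin i → Fin n} (j : Fin i)
    (h : l j = t) : omitProj t i (extMonomial k l) = 0 := by
  rw [omitProj, LinearMap.comp_apply, leftMul_extMonomial, extMonomial_eq_zero, map_zero]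
  intro hinj
  have := @hinj 0 j.succ (by simp [h])
  exact Fin.succ_ne_zero j this.symm

theorem omitProj_extMonomial_of_notMem {i : ℕ} {t : Fin n} {l : Fin i → Fin n}
    (h : ∀ j, l j ≠ t) : omitProj t i (extMonomial k l) = extMonomial k l := by
  refine Subtype.ext ?_
  change totalContract t (ExteriorAlgebra.ι k (Pi.single t (1 : k)) *
    (extMonomial k l : ExteriorAlgebra k (Fin n → k))) = _
  rw [totalContract_ι_mul, totalContract_extMonomial h, mul_zero, sub_zero, Pi.single_eq_same,
    one_smul]

theorem span_extMonomial (k : Type*) [Field k] (n i : ℕ) :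
    Submodule.span k (Set.range fun l : Fin i → Fin n => extMonomial k l) = ⊤ := by
  rw [← exteriorPower.ιMulti_span_of_span k i _ (Pi.basisFun k (Fin n)).span_eq]
  congr 1
  ext w
  constructor
  · rintro ⟨l, rfl⟩
    refine ⟨fun t => Pi.single (l t) (1 : k), ?_, rfl⟩
    rintro _ ⟨t, rfl⟩
    exact ⟨l t, Pi.basisFun_apply k (Fin n) (l t)⟩
  · rintro ⟨v, hv, rfl⟩
    choose l hl using fun t => hv (Set.mem_range_self t)
    refine ⟨l, ?_⟩
    refine congrArg (exteriorPower.ιMulti k i) (funext fun t => ?_)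
    rw [← hl t, Pi.basisFun_apply]

/-- A product of the projections `omitProj t` either kills a monomial or fixes it, and it fixes it
only if no `χ_t` with `t` in the list occurs. -/
theorem list_prod_omitProj_extMonomial {i : ℕ} (l : Fin i → Fin n) (L : List (Fin n)) :
    (L.map fun t => omitProj (k := k) t i).prod (extMonomial k l) = 0 ∨
      ((L.map fun t => omitProj (k := k) t i).prod (extMonomial k l) = extMonomial k l ∧
        ∀ t ∈ L, ∀ j, l j ≠ t) := by
  induction L with
  | nil => right; simp
  | cons t L ih =>
    rw [List.map_cons, List.prod_cons, Module.End.mul_apply]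
    rcases ih with h | ⟨h, h'⟩
    · left; rw [h, map_zero]
    · rw [h]
      by_cases ht : ∃ j, l j = t
      · obtain ⟨j, hj⟩ := ht
        exact Or.inl (omitProj_extMonomial_of_mem j hj)
      · push Not at ht
        refine Or.inr ⟨omitProj_extMonomial_of_notMem ht, ?_⟩
        simpa [ht] using h'

/-- No monomial of positive degree avoids all the `χ_t`. -/
theorem prod_omitProj_eq_zero (i : ℕ) :
    ((List.finRange n).map fun t => omitProj (k := k) t (i + 1)).prod = 0 := by
  refine LinearMap.ext_on_range (span_extMonomial k n (i + 1)) fun l => ?_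
  rcases list_prod_omitProj_extMonomial (k := k) l (List.finRange n) with h | ⟨-, h⟩
  · exact h
  · exact absurd rfl (h (l 0) (List.mem_finRange _) 0)

end ExteriorOperators

/-! ### Exactness of Koszul complexes -/

section Koszul

variable {k : Type*} [Field k] {n : ℕ} {P : Type*} [AddCommGroup P] [Module k P]
  {V : ℕ → Type*} [∀ i, AddCommGroup (V i)] [∀ i, Module k (V i)]

/-- The Koszul differential `V_{i+1} ⊗ P → V_i ⊗ P` of a family `θ_l` of operators on `P`. Here
`V_i` stands for `⋀^i W`, and `c_l` for the contraction by `x_l`. -/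
def koszul (c : Fin n → ∀ i, V (i + 1) →ₗ[k] V i) (θ : Fin n → Module.End k P) (i : ℕ) :
    V (i + 1) ⊗[k] P →ₗ[k] V i ⊗[k] P :=
  ∑ l, TensorProduct.map (c l i) (θ l)

theorem koszul_tmul (c : Fin n → ∀ i, V (i + 1) →ₗ[k] V i) (θ : Fin n → Module.End k P) (i : ℕ)
    (w : V (i + 1)) (x : P) : koszul c θ i (w ⊗ₜ x) = ∑ l, c l i w ⊗ₜ[k] θ l x := by
  rw [koszul, LinearMap.sum_apply]
  rfl

theorem koszul_comp_koszul {c : Fin n → ∀ i, V (i + 1) →ₗ[k] V i} {θ : Fin n → Module.End k P}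
    (hc : ∀ l t i, c l i ∘ₗ c t (i + 1) = -(c t i ∘ₗ c l (i + 1)))
    (hc0 : ∀ l i, c l i ∘ₗ c l (i + 1) = 0)
    (hθ : ∀ l t, θ l ∘ₗ θ t = θ t ∘ₗ θ l) (i : ℕ) :
    koszul c θ i ∘ₗ koszul c θ (i + 1) = 0 := by
  refine TensorProduct.ext' fun w x => ?_
  rw [LinearMap.comp_apply, koszul_tmul, map_sum]
  simp only [koszul_tmul]
  rw [← Finset.sum_product']
  refine Finset.sum_involution (fun a _ => a.swap) ?_ ?_ (fun _ _ => Finset.mem_univ _)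
    (fun _ _ => Prod.swap_swap _)
  · rintro ⟨t, l⟩ -
    change c l i (c t (i + 1) w) ⊗ₜ[k] θ l (θ t x) + c t i (c l (i + 1) w) ⊗ₜ[k] θ t (θ l x) = 0
    have h1 := LinearMap.congr_fun (hc l t i) w
    have h2 := LinearMap.congr_fun (hθ l t) x
    simp only [LinearMap.comp_apply, LinearMap.neg_apply] at h1 h2
    rw [h1, h2, TensorProduct.neg_tmul, neg_add_cancel]
  · rintro ⟨t, l⟩ - h heq
    obtain rfl : l = t := congrArg Prod.fst heq
    refine h ?_
    change c l i (c l (i + 1) w) ⊗ₜ[k] θ l (θ l x) = 0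
    have h1 := LinearMap.congr_fun (hc0 l i) w
    rw [LinearMap.comp_apply, LinearMap.zero_apply] at h1
    rw [h1, TensorProduct.zero_tmul]

/-- Suppose that `h` is a left inverse of `θ_t` and commutes with the other `θ_l`, and that `m`
(exterior multiplication by `χ_t`) and the contractions satisfy the Clifford relations. Then
`m ⊗ h` is a homotopy between the identity and the tensor product of the two projections that omit
`χ_t` and reduce modulo `θ_t`. -/
theorem koszul_homotopy {c : Fin n → ∀ i, V (i + 1) →ₗ[k] V i} {m : ∀ i, V i →ₗ[k] V (i + 1)}
    {θ : Fin n → Module.End k P} {h : Module.End k P} {t : Fin n}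
    (hcm : ∀ l i, l ≠ t → c l (i + 1) ∘ₗ m (i + 1) = -(m i ∘ₗ c l i))
    (hmc : ∀ i, m i ∘ₗ c t i = LinearMap.id - c t (i + 1) ∘ₗ m (i + 1))
    (hinv : h ∘ₗ θ t = LinearMap.id) (hcomm : ∀ l, l ≠ t → h ∘ₗ θ l = θ l ∘ₗ h) (i : ℕ)
    (u : V (i + 1) ⊗[k] P) :
    koszul c θ (i + 1) (TensorProduct.map (m (i + 1)) h u) +
        TensorProduct.map (m i) h (koszul c θ i u) =
      u - TensorProduct.map (c t (i + 1) ∘ₗ m (i + 1)) (LinearMap.id - θ t ∘ₗ h) u := by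
  induction u using TensorProduct.induction_on with
  | zero => simp only [map_zero, add_zero, sub_zero]
  | add x y hx hy =>
    simp only [map_add]
    rw [add_add_add_comm, hx, hy, add_sub_add_comm]
  | tmul w x =>
    rw [TensorProduct.map_tmul, koszul_tmul, koszul_tmul, map_sum, ← Finset.sum_add_distrib,
      Finset.sum_eq_single_of_mem t (Finset.mem_univ t)]
    · have h1 := LinearMap.congr_fun (hmc i) w
      have h2 := LinearMap.congr_fun hinv x
      simp only [LinearMap.comp_apply, LinearMap.sub_apply, LinearMap.id_apply] at h1 h2
      rw [TensorProduct.map_tmul, TensorProduct.map_tmul, h1, h2]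
      simp only [LinearMap.comp_apply, LinearMap.sub_apply, LinearMap.id_apply,
        TensorProduct.sub_tmul, TensorProduct.tmul_sub]
      abel
    · intro l _ hl
      have h1 := LinearMap.congr_fun (hcm l i hl) w
      have h2 := LinearMap.congr_fun (hcomm l hl) x
      simp only [LinearMap.comp_apply, LinearMap.neg_apply] at h1 h2
      rw [TensorProduct.map_tmul, h1, h2, TensorProduct.neg_tmul, neg_add_cancel]

/-- The composite of the projections of `koszul_homotopy` over all `t` is homotopic to the
identity. Hence the Koszul complex is exact where this composite vanishes. -/
theorem ker_koszul_le_range {c : Fin n → ∀ i, V (i + 1) →ₗ[k] V i}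
    {m : Fin n → ∀ i, V i →ₗ[k] V (i + 1)} {θ h : Fin n → Module.End k P}
    (hc : ∀ l t i, c l i ∘ₗ c t (i + 1) = -(c t i ∘ₗ c l (i + 1)))
    (hc0 : ∀ l i, c l i ∘ₗ c l (i + 1) = 0)
    (hcm : ∀ t l i, l ≠ t → c l (i + 1) ∘ₗ m t (i + 1) = -(m t i ∘ₗ c l i))
    (hmc : ∀ t i, m t i ∘ₗ c t i = LinearMap.id - c t (i + 1) ∘ₗ m t (i + 1))
    (hprod : ∀ i, ((List.finRange n).map
      fun t => (c t (i + 1) ∘ₗ m t (i + 1) : Module.End k (V (i + 1)))).prod = 0)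
    (hθ : ∀ l t, θ l ∘ₗ θ t = θ t ∘ₗ θ l) (hinv : ∀ t, h t ∘ₗ θ t = LinearMap.id)
    (hcomm : ∀ t l, l ≠ t → h t ∘ₗ θ l = θ l ∘ₗ h t) (i : ℕ) :
    LinearMap.ker (koszul c θ i) ≤ LinearMap.range (koszul c θ (i + 1)) := by
  intro u hu
  have key : ∀ L : List (Fin n), u - TensorProduct.map
      (L.map fun t => (c t (i + 1) ∘ₗ m t (i + 1) : Module.End k (V (i + 1)))).prod
      (L.map fun t => (LinearMap.id - θ t ∘ₗ h t : Module.End k P)).prod u ∈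
      LinearMap.range (koszul c θ (i + 1)) := by
    intro L
    induction L with
    | nil =>
      simp only [List.map_nil, List.prod_nil]
      rw [TensorProduct.map_one, Module.End.one_apply, sub_self]
      exact zero_mem _
    | cons t L ih =>
      -- The partial composite of the projections is homotopic to the identity, so it sends the
      -- cycle `u` to a cycle `v`, to which the homotopy for `t` applies.
      set v := TensorProduct.map
        (L.map fun t => (c t (i + 1) ∘ₗ m t (i + 1) : Module.End k (V (i + 1)))).prod
        (L.map fun t => (LinearMap.id - θ t ∘ₗ h t : Module.End k P)).prod u with hv
      have hv0 : koszul c θ i v = 0 := by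
        obtain ⟨y, hy⟩ := ih
        have h0 := LinearMap.congr_fun (koszul_comp_koszul hc hc0 hθ i) y
        rw [LinearMap.comp_apply, hy, map_sub, LinearMap.mem_ker.1 hu, zero_sub] at h0
        exact neg_eq_zero.1 h0
      have hhom := koszul_homotopy (hcm t) (hmc t) (hinv t) (hcomm t) i v
      rw [hv0, map_zero, add_zero] at hhom
      rw [List.map_cons, List.prod_cons, List.map_cons, List.prod_cons, TensorProduct.map_mul,
        Module.End.mul_apply, ← hv, ← sub_add_sub_cancel u v]
      refine add_mem ih ?_
      rw [← hhom]
      exact LinearMap.mem_range_self _ _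
  have := key (List.finRange n)
  rwa [hprod, TensorProduct.map_zero_left, LinearMap.zero_apply, sub_zero] at this

end Koszul

/-! ### The Nielsen complex as a Koszul complex -/

section Division

variable {k : Type*} [Field k] {n : ℕ} {M : Type*} [AddCommGroup M] [Module k M]

/-- Endomorphisms of `R ⊗ M = M[x_1, …, x_n]` agree if they agree on the products `x^a ⊗ μ`. -/
theorem end_tensor_ext {f g : Module.End k (MvPolynomial (Fin n) k ⊗[k] M)}
    (h : ∀ a μ, f (MvPolynomial.monomial a (1 : k) ⊗ₜ μ) =
      g (MvPolynomial.monomial a (1 : k) ⊗ₜ μ)) :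
    f = g := by
  refine TensorProduct.ext <| (MvPolynomial.basisMonomials (Fin n) k).ext fun a =>
    LinearMap.ext fun μ => ?_
  rw [MvPolynomial.coe_basisMonomials]
  exact h a μ

variable [Module (MvPolynomial (Fin n) k) M] [IsScalarTower k (MvPolynomial (Fin n) k) M]

variable (k M) in
/-- The multiplication by `x_l` on `M`. -/
def mulX (l : Fin n) : Module.End k M :=
  Algebra.lsmul k k M (MvPolynomial.X l : MvPolynomial (Fin n) k)

theorem mulX_apply (l : Fin n) (μ : M) :
    mulX k M l μ = (MvPolynomial.X l : MvPolynomial (Fin n) k) • μ := rfl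

theorem mulX_comm (l t : Fin n) (μ : M) :
    mulX k M l (mulX k M t μ) = mulX k M t (mulX k M l μ) := by
  simp only [mulX_apply, smul_smul, mul_comm]

variable (k M) in
/-- The operator `x_l ⊗ 1 - 1 ⊗ x_l` on `R ⊗ M`. -/
def diffX (l : Fin n) : Module.End k (MvPolynomial (Fin n) k ⊗[k] M) :=
  TensorProduct.map (LinearMap.mulLeft k (MvPolynomial.X l)) LinearMap.id -
    TensorProduct.map LinearMap.id (mulX k M l)

theorem diffX_tmul (l : Fin n) (r : MvPolynomial (Fin n) k) (μ : M) :
    diffX k M l (r ⊗ₜ[k] μ) = (MvPolynomial.X l * r) ⊗ₜ μ - r ⊗ₜ (mulX k M l μ) := rfl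

theorem diffX_comm (l t : Fin n) : diffX k M l ∘ₗ diffX k M t = diffX k M t ∘ₗ diffX k M l := by
  refine TensorProduct.ext' fun r μ => ?_
  simp only [LinearMap.comp_apply, diffX_tmul, map_sub, mulX_comm l t,
    mul_left_comm (MvPolynomial.X l) (MvPolynomial.X t)]
  abel

variable (k M) in
/-- The quotient of the division of `p ∈ R ⊗ M = M[x_1, …, x_n]` by `x_t ⊗ 1 - 1 ⊗ x_t`:
`x^a ⊗ μ ↦ ∑_{j < a_t} x^{a - (j + 1) e_t} ⊗ x_t^j μ`. The subtraction of exponents is not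
truncated here, as `j < a_t`. -/
def divX (t : Fin n) : Module.End k (MvPolynomial (Fin n) k ⊗[k] M) :=
  TensorProduct.lift <| (MvPolynomial.basisMonomials (Fin n) k).constr k fun a =>
    ∑ j ∈ Finset.range (a t),
      TensorProduct.mk k (MvPolynomial (Fin n) k) M
        (MvPolynomial.monomial (a - Finsupp.single t (j + 1)) 1) ∘ₗ mulX k M t ^ j

theorem divX_monomial_tmul (t : Fin n) (a : Fin n →₀ ℕ) (μ : M) :
    divX k M t (MvPolynomial.monomial a (1 : k) ⊗ₜ[k] μ) = ∑ j ∈ Finset.range (a t),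
      MvPolynomial.monomial (a - Finsupp.single t (j + 1)) (1 : k) ⊗ₜ[k] (mulX k M t ^ j) μ := by
  have h := (MvPolynomial.basisMonomials (Fin n) k).constr_basis k (fun a =>
    ∑ j ∈ Finset.range (a t),
      TensorProduct.mk k (MvPolynomial (Fin n) k) M
        (MvPolynomial.monomial (a - Finsupp.single t (j + 1)) 1) ∘ₗ mulX k M t ^ j) a
  rw [MvPolynomial.coe_basisMonomials] at h
  rw [divX, TensorProduct.lift.tmul, h, LinearMap.sum_apply]
  rfl

theorem X_mul_monomial (l : Fin n) (a : Fin n →₀ ℕ) :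
    MvPolynomial.X l * MvPolynomial.monomial a (1 : k) =
      MvPolynomial.monomial (a + Finsupp.single l 1) 1 := by
  rw [MvPolynomial.X, MvPolynomial.monomial_mul, one_mul, add_comm]

/-- This is the identity `(x_t^{c+1} - y^{c+1}) - (x_t^c - y^c) y = x_t^c (x_t - y)`, where `y` is
the action of `x_t` on `M`. -/
theorem divX_comp_diffX (t : Fin n) : divX k M t ∘ₗ diffX k M t = LinearMap.id := by
  refine end_tensor_ext fun a μ => ?_
  rw [LinearMap.comp_apply, diffX_tmul, X_mul_monomial, map_sub, divX_monomial_tmul,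
    divX_monomial_tmul, Finsupp.add_apply, Finsupp.single_eq_same, Finset.sum_range_succ',
    zero_add, add_tsub_cancel_right, pow_zero, add_comm, add_sub_assoc, LinearMap.id_apply,
    sub_eq_zero.2, add_zero, Module.End.one_apply]
  refine Finset.sum_congr rfl fun j _ => ?_
  rw [Finsupp.single_add t (j + 1) 1, add_tsub_add_eq_tsub_right, pow_succ, Module.End.mul_apply]

theorem divX_comp_diffX_ne {t l : Fin n} (hl : l ≠ t) :
    divX k M t ∘ₗ diffX k M l = diffX k M l ∘ₗ divX k M t := by
  refine end_tensor_ext fun a μ => ?_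
  have hat : (a + Finsupp.single l 1 : Fin n →₀ ℕ) t = a t := by
    rw [Finsupp.add_apply, Finsupp.single_eq_of_ne hl.symm, add_zero]
  rw [LinearMap.comp_apply, LinearMap.comp_apply, diffX_tmul, X_mul_monomial, map_sub,
    divX_monomial_tmul, divX_monomial_tmul, divX_monomial_tmul, hat, map_sum,
    ← Finset.sum_sub_distrib]
  refine Finset.sum_congr rfl fun j hj => ?_
  have hle : Finsupp.single t (j + 1) ≤ a := by
    rw [Finsupp.single_le_iff]
    exact Finset.mem_range.1 hj
  have hcomm : Commute (mulX k M t) (mulX k M l) :=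
    LinearMap.ext fun μ => mulX_comm t l μ
  rw [diffX_tmul, X_mul_monomial, tsub_add_eq_add_tsub hle, ← Module.End.mul_apply,
    ← Module.End.mul_apply, (hcomm.pow_left j).eq]

end Division

section NielsenExact

variable {k : Type*} [Field k] {n : ℕ} {M : Type*} [AddCommGroup M] [Module k M]

/-- To prove an additive property of the elements of a triple tensor product, it is enough to
consider the elements `r ⊗ w ⊗ μ`. -/
theorem tensor_induction {R V M : Type*} [AddCommMonoid R] [Module k R] [AddCommMonoid V]
    [Module k V] [AddCommMonoid M] [Module k M] {p : R ⊗[k] (V ⊗[k] M) → Prop} (h0 : p 0)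
    (ht : ∀ r w μ, p (r ⊗ₜ[k] (w ⊗ₜ[k] μ))) (hadd : ∀ a b, p a → p b → p (a + b)) (a) : p a := by
  induction a using TensorProduct.induction_on with
  | zero => exact h0
  | tmul r x =>
    induction x using TensorProduct.induction_on with
    | zero => rwa [TensorProduct.tmul_zero]
    | tmul w μ => exact ht r w μ
    | add x y hx hy => rw [TensorProduct.tmul_add]; exact hadd _ _ hx hy
  | add x y hx hy => exact hadd _ _ hx hy

variable [Module (MvPolynomial (Fin n) k) M] [IsScalarTower k (MvPolynomial (Fin n) k) M]
  {V : ℕ → Type*} [∀ i, AddCommGroup (V i)] [∀ i, Module k (V i)]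

variable (M) in
/-- The differential `R ⊗ V_{i+1} ⊗ M → R ⊗ V_i ⊗ M` of the Nielsen complex, for a family `V_i` of
vector spaces in place of the exterior powers and operators `c_l` in place of the contractions. -/
def genPhi (c : Fin n → ∀ i, V (i + 1) →ₗ[k] V i) (i : ℕ) :
    MvPolynomial (Fin n) k ⊗[k] (V (i + 1) ⊗[k] M) →ₗ[MvPolynomial (Fin n) k]
      MvPolynomial (Fin n) k ⊗[k] (V i ⊗[k] M) :=
  ∑ l : Fin n, ((MvPolynomial.X l : MvPolynomial (Fin n) k) •
      (TensorProduct.map (c l i) (LinearMap.id : M →ₗ[k] M)).baseChange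
        (MvPolynomial (Fin n) k) -
    (TensorProduct.map (c l i) (Algebra.lsmul k k M
      (MvPolynomial.X l : MvPolynomial (Fin n) k))).baseChange (MvPolynomial (Fin n) k))

/-- Moving `V_i` to the left turns `genPhi` into a Koszul differential. -/
theorem leftComm_genPhi (c : Fin n → ∀ i, V (i + 1) →ₗ[k] V i) (i : ℕ)
    (a : MvPolynomial (Fin n) k ⊗[k] (V (i + 1) ⊗[k] M)) :
    TensorProduct.leftComm k (MvPolynomial (Fin n) k) (V i) M (genPhi M c i a) =
      koszul c (diffX k M) i
        (TensorProduct.leftComm k (MvPolynomial (Fin n) k) (V (i + 1)) M a) := by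
  induction a using tensor_induction with
  | h0 => simp only [map_zero]
  | hadd a b ha hb => simp only [map_add, ha, hb]
  | ht r w μ =>
    rw [TensorProduct.leftComm_tmul, koszul_tmul, genPhi, LinearMap.sum_apply, map_sum]
    refine Finset.sum_congr rfl fun l _ => ?_
    simp only [diffX_tmul, mulX_apply, LinearMap.sub_apply, LinearMap.smul_apply,
      LinearMap.baseChange_tmul, TensorProduct.map_tmul, TensorProduct.smul_tmul', map_sub,
      TensorProduct.leftComm_tmul, TensorProduct.tmul_sub, LinearMap.id_apply, smul_eq_mul,
      Algebra.lsmul_coe]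

theorem range_genPhi {c : Fin n → ∀ i, V (i + 1) →ₗ[k] V i}
    {m : Fin n → ∀ i, V i →ₗ[k] V (i + 1)}
    (hc : ∀ l t i, c l i ∘ₗ c t (i + 1) = -(c t i ∘ₗ c l (i + 1)))
    (hc0 : ∀ l i, c l i ∘ₗ c l (i + 1) = 0)
    (hcm : ∀ t l i, l ≠ t → c l (i + 1) ∘ₗ m t (i + 1) = -(m t i ∘ₗ c l i))
    (hmc : ∀ t i, m t i ∘ₗ c t i = LinearMap.id - c t (i + 1) ∘ₗ m t (i + 1))
    (hprod : ∀ i, ((List.finRange n).map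
      fun t => (c t (i + 1) ∘ₗ m t (i + 1) : Module.End k (V (i + 1)))).prod = 0) (i : ℕ) :
    LinearMap.range (genPhi M c (i + 1)) = LinearMap.ker (genPhi M c i) := by
  refine le_antisymm ?_ fun u hu => ?_
  · rintro _ ⟨u, rfl⟩
    refine (TensorProduct.leftComm k (MvPolynomial (Fin n) k) (V i) M).injective ?_
    rw [leftComm_genPhi, leftComm_genPhi, map_zero]
    exact LinearMap.congr_fun (koszul_comp_koszul hc hc0 diffX_comm i) _
  · have h : koszul c (diffX k M) i
        (TensorProduct.leftComm k (MvPolynomial (Fin n) k) (V (i + 1)) M u) = 0 := by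
      rw [← leftComm_genPhi, LinearMap.mem_ker.1 hu, map_zero]
    obtain ⟨v, hv⟩ := ker_koszul_le_range hc hc0 hcm hmc hprod diffX_comm divX_comp_diffX
      (fun _ _ => divX_comp_diffX_ne) i h
    refine ⟨(TensorProduct.leftComm k (MvPolynomial (Fin n) k) (V (i + 2)) M).symm v,
      (TensorProduct.leftComm k (MvPolynomial (Fin n) k) (V (i + 1)) M).injective ?_⟩
    rw [leftComm_genPhi, LinearEquiv.apply_symm_apply, hv]

/-- Exactness of the Nielsen complex in positive degrees. -/
theorem range_phi_succ (i : ℕ) :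
    LinearMap.range (phi (k := k) (n := n) M (i + 1)) = LinearMap.ker (phi M i) :=
  range_genPhi (V := Ext k n) (c := contract) (m := leftMul) contract_comp_contract
    contract_comp_contract_self (fun _ _ i hl => contract_comp_leftMul_ne hl i)
    leftMul_comp_contract prod_omitProj_eq_zero i

end NielsenExact

/-! ### The augmentation -/

section Augmentation

variable {k : Type*} [Field k] {n : ℕ} {M : Type*} [AddCommGroup M] [Module k M]
  [Module (MvPolynomial (Fin n) k) M] [IsScalarTower k (MvPolynomial (Fin n) k) M]

variable (k n) in
/-- The unit of `⋀^0 W`. -/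
def extOne : Ext k n 0 := (exteriorPower.zeroEquiv k (Fin n → k)).symm 1

theorem ext_zero_eq_smul (w : Ext k n 0) :
    w = exteriorPower.zeroEquiv k (Fin n → k) w • extOne k n := by
  refine (exteriorPower.zeroEquiv k (Fin n → k)).injective ?_
  rw [map_smul, extOne, LinearEquiv.apply_symm_apply, smul_eq_mul, mul_one]

theorem augmentation_one_tmul (r : MvPolynomial (Fin n) k) (μ : M) :
    augmentation k n M (r ⊗ₜ[k] (extOne k n ⊗ₜ[k] μ)) = r • μ := by
  rw [augmentation_tmul, extOne, LinearEquiv.apply_symm_apply, one_smul]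

theorem augmentation_surjective : Function.Surjective (augmentation k n M) := fun μ =>
  ⟨1 ⊗ₜ[k] (extOne k n ⊗ₜ[k] μ), by rw [augmentation_one_tmul, one_smul]⟩

theorem augmentation_phi (a : NielsenA k n M 1) : augmentation k n M (phi M 0 a) = 0 := by
  induction a using tensor_induction with
  | h0 => simp only [map_zero]
  | hadd a b ha hb => rw [map_add, map_add, ha, hb, add_zero]
  | ht r w μ =>
    rw [phi_tmul, map_sub, map_sum, map_sum, ← Finset.sum_sub_distrib]
    refine Finset.sum_eq_zero fun l _ => ?_
    rw [augmentation_tmul, augmentation_tmul, smul_comm _ _ μ, mul_comm, mul_smul,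
      sub_eq_zero]
    simp only [smul_comm _ (exteriorPower.zeroEquiv k (Fin n → k) _)]

theorem leftMul_extOne_contract (l t : Fin n) :
    contract t 0 (leftMul l 0 (extOne k n)) = if l = t then extOne k n else 0 := by
  refine Subtype.ext ?_
  change totalContract t (ExteriorAlgebra.ι k (Pi.single l (1 : k)) *
    (extOne k n : ExteriorAlgebra k (Fin n → k))) = _
  rw [totalContract_ι_mul, totalContract_zero_ext, mul_zero, sub_zero, Pi.single_apply]
  split_ifs <;> simp_all

theorem sub_mem_of_eq {R F : Type*} [Ring R] [AddCommGroup F] [Module R F] {S : Submodule R F}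
    {x y : F} (h : x = y) : x - y ∈ S := by
  rw [h, sub_self]
  exact zero_mem _

/-- Modulo the image of `φ_1`, the elements `r ⊗ 1 ⊗ μ` and `1 ⊗ 1 ⊗ r μ` agree. -/
theorem tmul_sub_tmul_mem_range_phi (r : MvPolynomial (Fin n) k) (μ : M) :
    r ⊗ₜ[k] (extOne k n ⊗ₜ[k] μ) - 1 ⊗ₜ[k] (extOne k n ⊗ₜ[k] (r • μ)) ∈
      LinearMap.range (phi (k := k) (n := n) M 0) := by
  induction r using MvPolynomial.induction_on generalizing μ with
  | C c =>
    rw [← MvPolynomial.algebraMap_eq, algebraMap_smul, Algebra.algebraMap_eq_smul_one,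
      ← TensorProduct.smul_tmul', TensorProduct.tmul_smul, TensorProduct.tmul_smul]
    refine sub_mem_of_eq ?_
    rfl
  | add p q hp hq =>
    rw [add_smul, TensorProduct.tmul_add, TensorProduct.tmul_add, TensorProduct.add_tmul,
      add_sub_add_comm]
    exact add_mem (hp μ) (hq μ)
  | mul_X p l hp =>
    rw [mul_smul, ← sub_add_sub_cancel _ (p ⊗ₜ[k] (extOne k n ⊗ₜ[k]
      ((MvPolynomial.X l : MvPolynomial (Fin n) k) • μ)))]
    refine add_mem ⟨p ⊗ₜ[k] (leftMul l 0 (extOne k n) ⊗ₜ[k] μ), ?_⟩ (hp _)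
    rw [phi_tmul, Finset.sum_eq_single_of_mem l (Finset.mem_univ l),
      Finset.sum_eq_single_of_mem l (Finset.mem_univ l), leftMul_extOne_contract, if_pos rfl,
      mul_comm]
    all_goals
      intro t _ ht
      rw [leftMul_extOne_contract, if_neg ht.symm, TensorProduct.zero_tmul, TensorProduct.tmul_zero]

theorem sub_augmentation_mem_range_phi (a : NielsenA k n M 0) :
    a - 1 ⊗ₜ[k] (extOne k n ⊗ₜ[k] augmentation k n M a) ∈
      LinearMap.range (phi (k := k) (n := n) M 0) := by
  induction a using tensor_induction with
  | h0 => simp only [map_zero, TensorProduct.tmul_zero, sub_self, zero_mem]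
  | hadd a b ha hb =>
    rw [map_add, TensorProduct.tmul_add, TensorProduct.tmul_add, add_sub_add_comm]
    exact add_mem ha hb
  | ht r w μ =>
    rw [ext_zero_eq_smul w, TensorProduct.smul_tmul, augmentation_one_tmul]
    exact tmul_sub_tmul_mem_range_phi r _

/-- Exactness of the Nielsen complex in degree `0`. -/
theorem range_phi_zero :
    LinearMap.range (phi (k := k) (n := n) M 0) = LinearMap.ker (augmentation k n M) := by
  refine le_antisymm ?_ fun u hu => ?_
  · rintro _ ⟨u, rfl⟩
    exact augmentation_phi u
  · have h := sub_augmentation_mem_range_phi u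
    rwa [LinearMap.mem_ker.1 hu, TensorProduct.tmul_zero, TensorProduct.tmul_zero, sub_zero] at h

end Augmentation

/-- The Nielsen complex is exact. -/
theorem range_phi_eq_kerOut {k : Type*} [Field k] {n : ℕ} {M : Type*} [AddCommGroup M] [Module k M]
    [Module (MvPolynomial (Fin n) k) M] [IsScalarTower k (MvPolynomial (Fin n) k) M] (i : ℕ) :
    LinearMap.range (phi (k := k) (n := n) M i) = kerOut (phi M) (augmentation k n M) i :=
  match i with
  | 0 => range_phi_zero
  | i + 1 => range_phi_succ i

/-! ### Dual bases -/

section DualBasis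

variable {k : Type*} [Field k] {n : ℕ} {F : Type*} [AddCommGroup F]
  [Module (MvPolynomial (Fin n) k) F] {G : Type*} [AddCommGroup G]
  [Module (MvPolynomial (Fin n) k) G] {ι : Type*} [Finite ι]

/-- The basis of `Hom_R(F, D)` dual to the basis `b` of `F`, where `D` is free of rank one with
basis `c`. -/
def homBasis (b : Module.Basis ι (MvPolynomial (Fin n) k) F)
    (c : Module.Basis Unit (MvPolynomial (Fin n) k) G) :
    Module.Basis ι (MvPolynomial (Fin n) k) (F →ₗ[MvPolynomial (Fin n) k] G) :=
  letI := Classical.decEq ι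
  b.dualBasis.map <| LinearEquiv.congrRight <|
    (c.repr ≪≫ₗ Finsupp.uniqueLinearEquiv _ _ ()).symm

theorem homBasis_apply [DecidableEq ι] (b : Module.Basis ι (MvPolynomial (Fin n) k) F)
    (c : Module.Basis Unit (MvPolynomial (Fin n) k) G) (i : ι) (f : F) :
    homBasis b c i f = b.repr f i • c () := by
  refine c.ext_elem fun u => ?_
  simp [homBasis, LinearEquiv.congrRight]

theorem homBasis_repr (b : Module.Basis ι (MvPolynomial (Fin n) k) F)
    (c : Module.Basis Unit (MvPolynomial (Fin n) k) G) (f : F →ₗ[MvPolynomial (Fin n) k] G)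
    (t : ι) : (homBasis b c).repr f t = c.repr (f (b t)) () := by
  simp [homBasis, LinearEquiv.congrRight]

end DualBasis

/-! ### Gradings given by homogeneous bases -/

section StdGrading

variable {k : Type*} [Field k] {n : ℕ} (d : Fin n → ℤ)
  {F : Type*} [AddCommGroup F] [Module k F] [Module (MvPolynomial (Fin n) k) F]
  [IsScalarTower k (MvPolynomial (Fin n) k) F]
  {G : Type*} [AddCommGroup G] [Module k G] [Module (MvPolynomial (Fin n) k) G]
  [IsScalarTower k (MvPolynomial (Fin n) k) G]
  {ι : Type*}

/-- The grading of a free module for which the basis vector `b t` is homogeneous of degree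
`deg t`: an element has degree `j` if its coordinate at each `t` has degree `j - deg t`. -/
def stdGrading (b : Module.Basis ι (MvPolynomial (Fin n) k) F) (deg : ι → ℤ) (j : ℤ) :
    Submodule k F where
  carrier := {f | ∀ t, b.repr f t ∈ MvPolynomial.weightedHomogeneousSubmodule k d (j - deg t)}
  add_mem' hf hg t := by
    rw [map_add, Finsupp.add_apply]
    exact add_mem (hf t) (hg t)
  zero_mem' t := by
    rw [map_zero, Finsupp.zero_apply]
    exact zero_mem _
  smul_mem' c f hf t := by
    rw [← algebraMap_smul (MvPolynomial (Fin n) k) c f, map_smul, Finsupp.smul_apply,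
      algebraMap_smul]
    exact Submodule.smul_mem _ c (hf t)

variable {d}

theorem mul_mem_weighted {i j l : ℤ} (h : i + j = l) {r r' : MvPolynomial (Fin n) k}
    (hr : r ∈ MvPolynomial.weightedHomogeneousSubmodule k d i)
    (hr' : r' ∈ MvPolynomial.weightedHomogeneousSubmodule k d j) :
    r * r' ∈ MvPolynomial.weightedHomogeneousSubmodule k d l := by
  subst h
  exact MvPolynomial.IsWeightedHomogeneous.mul hr hr'

theorem smul_mem_stdGrading {b : Module.Basis ι (MvPolynomial (Fin n) k) F} {deg : ι → ℤ}
    (i j : ℤ) (r : MvPolynomial (Fin n) k) (a : F)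
    (hr : r ∈ MvPolynomial.weightedHomogeneousSubmodule k d i) (ha : a ∈ stdGrading d b deg j) :
    r • a ∈ stdGrading d b deg (i + j) := by
  intro t
  rw [map_smul, Finsupp.smul_apply, smul_eq_mul]
  exact mul_mem_weighted (by ring) hr (ha t)

theorem basis_mem_stdGrading (b : Module.Basis ι (MvPolynomial (Fin n) k) F) (deg : ι → ℤ)
    (t : ι) : b t ∈ stdGrading d b deg (deg t) := by
  intro t'
  rw [b.repr_self]
  by_cases h : t = t'
  · subst h
    rw [Finsupp.single_eq_same, sub_self]
    exact MvPolynomial.isWeightedHomogeneous_one k d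
  · rw [Finsupp.single_eq_of_ne' h]
    exact zero_mem _

theorem smul_basis_mem_stdGrading (b : Module.Basis ι (MvPolynomial (Fin n) k) F) (deg : ι → ℤ)
    (t : ι) {i j : ℤ} (h : i + deg t = j) {r : MvPolynomial (Fin n) k}
    (hr : r ∈ MvPolynomial.weightedHomogeneousSubmodule k d i) :
    r • b t ∈ stdGrading d b deg j :=
  h ▸ smul_mem_stdGrading i (deg t) r (b t) hr (basis_mem_stdGrading b deg t)

theorem stdGrading_isInternal (b : Module.Basis ι (MvPolynomial (Fin n) k) F) (deg : ι → ℤ) :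
    DirectSum.IsInternal (stdGrading d b deg) := by
  constructor
  · -- The coordinates of an element of degree `i` at `t` are homogeneous of degree `i - deg t`, so
    -- they are recovered from the coordinates of a sum as homogeneous components.
    have key : ∀ (x : DirectSum ℤ fun j => stdGrading d b deg j) (i : ℤ) (t : ι),
        b.repr (x i : F) t = MvPolynomial.weightedHomogeneousComponent d (i - deg t)
          (b.repr (DirectSum.coeAddMonoidHom (stdGrading d b deg) x) t) := by
      intro x i t
      induction x using DirectSum.induction_on with
      | zero => simp
      | add x y hx hy =>
        rw [DirectSum.add_apply, Submodule.coe_add, map_add, map_add, map_add, Finsupp.add_apply,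
          Finsupp.add_apply, map_add, hx, hy]
      | of j x =>
        rw [DirectSum.coeAddMonoidHom_of]
        by_cases hij : j = i
        · subst hij
          rw [DirectSum.of_eq_same]
          exact (MvPolynomial.IsWeightedHomogeneous.weightedHomogeneousComponent_same
            (x.2 t)).symm
        · rw [DirectSum.of_eq_of_ne _ _ _ (Ne.symm hij),
            MvPolynomial.IsWeightedHomogeneous.weightedHomogeneousComponent_ne (i - deg t) (x.2 t)
              (fun h => hij (by linarith))]
          simp
    refine (injective_iff_map_eq_zero _).2 fun x hx => DFinsupp.ext fun i => Subtype.ext ?_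
    refine b.repr.injective (Finsupp.ext fun t => ?_)
    rw [key, hx]
    simp
  · -- A multiple of a basis vector by a monomial of `R` is homogeneous, and these span.
    have h : ∀ f : F, f ∈ ⨆ j, stdGrading d b deg j := by
      intro f
      rw [← b.linearCombination_repr f, Finsupp.linearCombination_apply, Finsupp.sum]
      refine Submodule.sum_mem _ fun t _ => ?_
      rw [(b.repr f t).as_sum, Finset.sum_smul]
      refine Submodule.sum_mem _ fun u _ => ?_
      exact Submodule.mem_iSup_of_mem (Finsupp.weight d u + deg t) <|
        smul_basis_mem_stdGrading b deg t rfl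
          (MvPolynomial.isWeightedHomogeneous_monomial d u _ rfl)
    have htop : LinearMap.range (DirectSum.coeLinearMap (stdGrading d b deg)) = ⊤ := by
      rw [DirectSum.range_coeLinearMap, eq_top_iff]
      exact fun f _ => h f
    exact LinearMap.range_eq_top.1 htop

theorem isGradedFree_stdGrading [Finite ι] (b : Module.Basis ι (MvPolynomial (Fin n) k) F)
    (deg : ι → ℤ) : IsGradedFree d (stdGrading d b deg) where
  isInternal := stdGrading_isInternal b deg
  smul_mem := smul_mem_stdGrading
  exists_basis := by
    obtain ⟨N, ⟨e⟩⟩ := Finite.exists_equiv_fin ι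
    refine ⟨N, b.reindex e, fun t => ⟨deg (e.symm t), ?_⟩⟩
    rw [b.reindex_apply]
    exact basis_mem_stdGrading b deg _

/-- A graded injective map between graded modules reflects degrees. -/
theorem mem_of_map_mem {E E' : Type*} [AddCommGroup E] [Module k E] [AddCommGroup E'] [Module k E']
    {𝒜 : ℤ → Submodule k E} {ℬ : ℤ → Submodule k E'} (h𝒜 : DirectSum.IsInternal 𝒜)
    (hℬ : DirectSum.IsInternal ℬ) {S : Type*} [Semiring S] [Module S E]
    [Module S E'] {f : E →ₗ[S] E'} (hf : Function.Injective f)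
    (hgr : IsGradedMap 𝒜 ℬ f) {j : ℤ} {a : E} (ha : f a ∈ ℬ j) : a ∈ 𝒜 j := by
  let := h𝒜.chooseDecomposition
  let := hℬ.chooseDecomposition
  have key : ∀ x : E, ∀ i, f (DirectSum.decompose 𝒜 x i) = DirectSum.decompose ℬ (f x) i := by
    intro x i
    induction x using DirectSum.Decomposition.inductionOn 𝒜 with
    | zero => simp
    | add x y hx hy => simp [hx, hy]
    | homogeneous x =>
      rename_i l
      by_cases hl : l = i
      · subst hl
        rw [DirectSum.decompose_of_mem_same 𝒜 x.2, DirectSum.decompose_of_mem_same ℬ (hgr l x x.2)]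
      · rw [DirectSum.decompose_of_mem_ne 𝒜 x.2 hl, DirectSum.decompose_of_mem_ne ℬ (hgr l x x.2) hl,
          map_zero]
  have h1 := key a j
  rw [DirectSum.decompose_of_mem_same ℬ ha] at h1
  rw [← hf h1]
  exact (DirectSum.decompose 𝒜 a j).2

/-- The grading of a graded free module is determined by the degrees of a homogeneous basis. -/
theorem IsGradedFree.eq_stdGrading {𝒜 : ℤ → Submodule k F} (h : IsGradedFree d 𝒜)
    {b : Module.Basis ι (MvPolynomial (Fin n) k) F} {deg : ι → ℤ} (hb : ∀ t, b t ∈ 𝒜 (deg t)) :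
    𝒜 = stdGrading d b deg := by
  have hle : ∀ j, stdGrading d b deg j ≤ 𝒜 j := by
    intro j f hf
    rw [← b.linearCombination_repr f, Finsupp.linearCombination_apply, Finsupp.sum]
    refine Submodule.sum_mem _ fun t _ => ?_
    have := h.smul_mem _ _ _ _ (hf t) (hb t)
    rwa [sub_add_cancel] at this
  refine funext fun j => le_antisymm (fun f hf => ?_) (hle j)
  exact mem_of_map_mem (f := (LinearMap.id : F →ₗ[k] F)) (stdGrading_isInternal b deg) h.isInternal
    Function.injective_id hle hf

section Hom

variable [Finite ι]

/-- If `G` is free of rank one on a generator of degree `D`, the basis of `Hom(F, G)(-s)` dual to a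
homogeneous basis is homogeneous, and it determines the grading. -/
theorem homGrading_stdGrading (b : Module.Basis ι (MvPolynomial (Fin n) k) F) (deg : ι → ℤ)
    (c : Module.Basis Unit (MvPolynomial (Fin n) k) G) (D s : ℤ) :
    homGrading (stdGrading d b deg) (stdGrading d c fun _ => D) s =
      stdGrading d (homBasis b c) fun t => D + s - deg t := by
  refine funext fun j => le_antisymm (fun f hf t => ?_) fun f hf e a ha => ?_
  · rw [homBasis_repr]
    have := hf (deg t) (b t) (basis_mem_stdGrading b deg t) ()
    rwa [show deg t + (j - s) - D = j - (D + s - deg t) by ring] at this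
  · rw [← b.linearCombination_repr a, Finsupp.linearCombination_apply, Finsupp.sum, map_sum]
    refine Submodule.sum_mem _ fun t _ u => ?_
    rw [LinearMap.map_smul, LinearEquiv.map_smul, Finsupp.smul_apply, smul_eq_mul]
    refine mul_mem_weighted ?_ (ha t) (homBasis_repr b c f t ▸ hf t)
    ring

end Hom

end StdGrading

/-! ### Homogeneous bases of vector spaces -/

section Adapted

variable {k : Type*} [Field k]

/-- `b` is a basis of homogeneous elements, where `b t` has degree `deg t`, and each graded piece
is spanned by the elements of `b` that it contains. -/
def IsAdapted {ι V : Type*} [AddCommGroup V] [Module k V] (𝒱 : ℤ → Submodule k V)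
    (b : Module.Basis ι k V) (deg : ι → ℤ) : Prop :=
  ∀ j, 𝒱 j = Submodule.span k (b '' {t | deg t = j})

theorem IsAdapted.mem {ι V : Type*} [AddCommGroup V] [Module k V] {𝒱 : ℤ → Submodule k V}
    {b : Module.Basis ι k V} {deg : ι → ℤ} (h : IsAdapted 𝒱 b deg) (t : ι) : b t ∈ 𝒱 (deg t) := by
  rw [h]
  exact Submodule.subset_span ⟨t, rfl, rfl⟩

/-- A graded finite-dimensional vector space has a finite homogeneous basis. -/
theorem exists_isAdapted {V : Type*} [AddCommGroup V] [Module k V] [Module.Finite k V]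
    (𝒱 : ℤ → Submodule k V) (h : DirectSum.IsInternal 𝒱) :
    ∃ (N : ℕ) (b : Module.Basis (Fin N) k V) (deg : Fin N → ℤ), IsAdapted 𝒱 b deg := by
  let v := fun i => Module.Basis.ofVectorSpace k (𝒱 i)
  let b := h.collectedBasis v
  have : Finite (Σ i, Module.Basis.ofVectorSpaceIndex k (𝒱 i)) := Module.Finite.finite_basis b
  obtain ⟨N, ⟨e⟩⟩ := Finite.exists_equiv_fin (Σ i, Module.Basis.ofVectorSpaceIndex k (𝒱 i))
  refine ⟨N, b.reindex e, fun t => (e.symm t).1, fun j => le_antisymm (fun x hx => ?_) ?_⟩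
  · rw [Module.Basis.mem_span_image]
    intro t ht
    by_contra hne
    refine (Finsupp.mem_support_iff.1 ht) ?_
    rw [b.repr_reindex_apply]
    exact h.collectedBasis_repr_of_mem_ne v (Ne.symm hne) hx
  · rw [Submodule.span_le]
    rintro _ ⟨t, rfl, rfl⟩
    rw [b.reindex_apply]
    exact h.collectedBasis_mem v _

end Adapted

/-! ### Gradings of exterior powers -/

section ExtGrading

variable {k : Type*} [Field k] {n : ℕ} {d : Fin n → ℤ}

theorem extMonomial_mem {i : ℕ} (l : Fin i → Fin n) {j : ℤ} (h : ∑ t, d (l t) = j) :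
    extMonomial k l ∈ extGrading k d i j :=
  Submodule.subset_span ⟨l, h, rfl⟩

/-- To prove a linear property of the homogeneous elements of degree `j` of `⋀^i W`, it is enough to
consider the monomials of degree `j`. -/
theorem extGrading_le {i : ℕ} {j : ℤ} {S : Submodule k (Ext k n i)}
    (h : ∀ l : Fin i → Fin n, ∑ t, d (l t) = j → extMonomial k l ∈ S) : extGrading k d i j ≤ S := by
  refine Submodule.span_le.2 ?_
  rintro _ ⟨l, hl, rfl⟩
  exact h l hl

theorem leftMul_mem_extGrading (t : Fin n) {i : ℕ} {j j' : ℤ} (h : d t + j = j') {w : Ext k n i}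
    (hw : w ∈ extGrading k d i j) : leftMul t i w ∈ extGrading k d (i + 1) j' := by
  refine extGrading_le (S := (extGrading k d (i + 1) j').comap (leftMul t i)) (fun l hl => ?_) hw
  rw [Submodule.mem_comap, leftMul_extMonomial]
  refine extMonomial_mem _ ?_
  rw [Fin.sum_univ_succ, Fin.cons_zero, ← h, ← hl]
  simp only [Fin.cons_succ]

theorem contract_extMonomial_mem (t : Fin n) {i : ℕ} (l : Fin (i + 1) → Fin n) {j : ℤ}
    (h : ∑ u, d (l u) = d t + j) : contract t i (extMonomial k l) ∈ extGrading k d i j := by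
  induction i generalizing j with
  | zero =>
    by_cases hl : l 0 = t
    · have : extGrading k d 0 j = ⊤ := by
        rw [eq_top_iff, ← span_extMonomial k n 0, Submodule.span_le]
        rintro _ ⟨l', rfl⟩
        refine extMonomial_mem l' ?_
        rw [Fin.sum_univ_one, hl] at h
        rw [Fin.sum_univ_zero]
        linarith
      rw [this]
      exact Submodule.mem_top
    · have : contract t 0 (extMonomial k l) = 0 := by
        refine Subtype.ext (totalContract_extMonomial fun u => ?_)
        obtain rfl : u = 0 := Fin.fin_one_eq_zero u
        exact hl
      rw [this]
      exact zero_mem _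
  | succ i ih =>
    have hexp : contract t (i + 1) (extMonomial k l) =
        (Pi.single (l 0) (1 : k) : Fin n → k) t • extMonomial k (Fin.tail l) -
          leftMul (l 0) i (contract t i (extMonomial k (Fin.tail l))) := by
      rw [extMonomial_succ]
      exact Subtype.ext (totalContract_ι_mul t _ _)
    rw [Fin.sum_univ_succ] at h
    rw [hexp]
    refine sub_mem ?_ ?_
    · by_cases hl : l 0 = t
      · refine Submodule.smul_mem _ _ (extMonomial_mem _ ?_)
        rw [hl] at h
        exact add_left_cancel h
      · rw [Pi.single_eq_of_ne (Ne.symm hl), zero_smul]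
        exact zero_mem _
    · refine leftMul_mem_extGrading (j := j - d (l 0)) _ (by ring) (ih (Fin.tail l) ?_)
      simp only [Fin.tail]
      linarith

theorem contract_mem_extGrading (t : Fin n) {i : ℕ} {j j' : ℤ} (h : d t + j' = j)
    {w : Ext k n (i + 1)} (hw : w ∈ extGrading k d (i + 1) j) :
    contract t i w ∈ extGrading k d i j' :=
  extGrading_le (S := (extGrading k d i j').comap (contract t i))
    (fun l hl => contract_extMonomial_mem t l (hl.trans h.symm)) hw

theorem wedge_mem_extGrading {p q r : ℕ} (h : p + q = r) {j j' j'' : ℤ} (hj : j + j' = j'')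
    {a : Ext k n p} {b : Ext k n q} (ha : a ∈ extGrading k d p j) (hb : b ∈ extGrading k d q j') :
    wedge h a b ∈ extGrading k d r j'' := by
  subst h hj
  refine extGrading_le (S := (extGrading k d (p + q) (j + j')).comap ((wedge rfl).flip b))
    (fun l hl => ?_) ha
  refine extGrading_le (S := (extGrading k d (p + q) (j + j')).comap (wedge rfl (extMonomial k l)))
    (fun l' hl' => ?_) hb
  have : wedge rfl (extMonomial k l) (extMonomial k l') = extMonomial k (Fin.append l l') := by
    refine Subtype.ext ((ExteriorAlgebra.ιMulti_mul_ιMulti _ _).trans ?_)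
    refine congrArg (ExteriorAlgebra.ιMulti k (p + q)) (funext fun t => ?_)
    refine Fin.addCases (fun i => ?_) (fun i => ?_) t
    · rw [Fin.append_left, Fin.append_left]
    · rw [Fin.append_right, Fin.append_right]
  rw [Submodule.mem_comap, this]
  refine extMonomial_mem _ ?_
  rw [Fin.sum_univ_add, ← hl, ← hl']
  simp only [Fin.append_left, Fin.append_right]

/-- The basis of `⋀^i W` that consists of the increasing monomials. -/
def extBasis (k : Type*) [Field k] (n i : ℕ) :
    Module.Basis (Set.powersetCard (Fin n) i) k (Ext k n i) :=
  (Pi.basisFun k (Fin n)).exteriorPower i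

/-- The degree of an increasing monomial. -/
def extDeg (d : Fin n → ℤ) (i : ℕ) (S : Set.powersetCard (Fin n) i) : ℤ :=
  ∑ t, d (Set.powersetCard.ofFinEmbEquiv.symm S t)

theorem extBasis_apply (i : ℕ) (S : Set.powersetCard (Fin n) i) :
    extBasis k n i S = extMonomial k (Set.powersetCard.ofFinEmbEquiv.symm S) := by
  rw [extBasis, exteriorPower.basis_apply]
  refine congrArg (exteriorPower.ιMulti k i) (funext fun t => ?_)
  rw [Function.comp_apply, Pi.basisFun_apply]

theorem extBasis_isAdapted (d : Fin n → ℤ) (i : ℕ) :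
    IsAdapted (extGrading k d i) (extBasis k n i) (extDeg d i) := by
  refine fun j => le_antisymm (extGrading_le fun l hl => ?_) (Submodule.span_le.2 ?_)
  · -- A nonzero coordinate is a determinant with a nonzero term, so that the monomials agree up to
    -- a permutation of the factors.
    rw [Module.Basis.mem_span_image]
    intro S hS
    rw [Finset.mem_coe, Finsupp.mem_support_iff, extBasis, exteriorPower.basis_repr_apply,
      extMonomial, exteriorPower.ιMultiDual_apply_ιMulti, Matrix.det_apply] at hS
    obtain ⟨σ, -, hσ⟩ := Finset.exists_ne_zero_of_sum_ne_zero hS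
    have hσ' : ∀ t, l (σ t) = Set.powersetCard.ofFinEmbEquiv.symm S t := by
      intro t
      by_contra hne
      refine hσ ?_
      rw [Finset.prod_eq_zero (Finset.mem_univ t), smul_zero]
      rw [Matrix.of_apply, Module.Basis.coord_apply, Pi.basisFun_repr]
      exact Pi.single_eq_of_ne (Ne.symm hne) _
    change ∑ t, d (Set.powersetCard.ofFinEmbEquiv.symm S t) = j
    rw [← hl, ← Equiv.sum_comp σ fun t => d (l t)]
    exact Finset.sum_congr rfl fun t _ => by rw [hσ']
  · rintro _ ⟨S, rfl, rfl⟩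
    rw [extBasis_apply]
    exact extMonomial_mem _ rfl

theorem finrank_ext (i : ℕ) : Module.finrank k (Ext k n i) = n.choose i := by
  rw [exteriorPower.finrank_eq, Module.finrank_fin_fun]

/-- `⋀^n W` is a line of degree `∑ l, d l`. -/
theorem mem_extGrading_top (d : Fin n → ℤ) (w : Ext k n n) :
    w ∈ extGrading k d n (∑ l, d l) := by
  have h := (extBasis k n n).span_eq
  have hle : Submodule.span k (Set.range (extBasis k n n)) ≤ extGrading k d n (∑ l, d l) := by
    refine Submodule.span_le.2 ?_
    rintro _ ⟨S, rfl⟩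
    rw [extBasis_apply]
    refine extMonomial_mem _ ?_
    have hb : Function.Bijective (Set.powersetCard.ofFinEmbEquiv.symm S) :=
      Finite.injective_iff_bijective.1 (Set.powersetCard.ofFinEmbEquiv.symm S).injective
    exact hb.sum_comp d
  exact hle (h ▸ Submodule.mem_top)

theorem extGrading_top_eq_bot {j : ℤ} (hj : j ≠ ∑ l, d l) : extGrading k d n j = ⊥ := by
  refine le_bot_iff.1 (extGrading_le fun l hl => ?_)
  rw [Submodule.mem_bot]
  refine extMonomial_eq_zero fun hinj => hj ?_
  rw [← hl]
  exact (Finite.injective_iff_bijective.1 hinj).sum_comp d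

end ExtGrading

/-! ### Gradings of the Nielsen complex -/

section NielsenGrading

variable {k : Type*} [Field k] {n : ℕ} {d : Fin n → ℤ} {M : Type*} [AddCommGroup M] [Module k M]

theorem tmul_mem_nielsenGrading {ℳ : ℤ → Submodule k M} {i : ℕ} {j j₁ j₂ j₃ : ℤ}
    (h : j₁ + j₂ + j₃ = j) {r : MvPolynomial (Fin n) k} {w : Ext k n i} {μ : M}
    (hr : r ∈ MvPolynomial.weightedHomogeneousSubmodule k d j₁) (hw : w ∈ extGrading k d i j₂)
    (hμ : μ ∈ ℳ j₃) : r ⊗ₜ[k] (w ⊗ₜ[k] μ) ∈ nielsenGrading d ℳ i j :=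
  Submodule.subset_span ⟨j₁, j₂, j₃, h, r, hr, w, hw, μ, hμ, rfl⟩

/-- Graded maps can be recognized on the elements `r ⊗ w ⊗ μ` with homogeneous factors. -/
theorem nielsenGrading_le {d : Fin n → ℤ} {ℳ : ℤ → Submodule k M} {i : ℕ} {j : ℤ}
    {S : Submodule k (NielsenA k n M i)}
    (h : ∀ j₁ j₂ j₃ : ℤ, j₁ + j₂ + j₃ = j →
      ∀ r ∈ MvPolynomial.weightedHomogeneousSubmodule k d j₁, ∀ w ∈ extGrading k d i j₂,
      ∀ μ ∈ ℳ j₃, r ⊗ₜ[k] (w ⊗ₜ[k] μ) ∈ S) : nielsenGrading d ℳ i j ≤ S := by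
  refine Submodule.span_le.2 ?_
  rintro _ ⟨j₁, j₂, j₃, hj, r, hr, w, hw, μ, hμ, rfl⟩
  exact h j₁ j₂ j₃ hj r hr w hw μ hμ

/-- The basis of `A_i(M)` given by the increasing monomials and a basis of `M`. -/
def nielsenBasis (i : ℕ) {ι : Type*} (b : Module.Basis ι k M) :
    Module.Basis (Set.powersetCard (Fin n) i × ι) (MvPolynomial (Fin n) k) (NielsenA k n M i) :=
  ((extBasis k n i).tensorProduct b).baseChange (MvPolynomial (Fin n) k)

theorem nielsenBasis_apply (i : ℕ) {ι : Type*} (b : Module.Basis ι k M)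
    (t : Set.powersetCard (Fin n) i × ι) :
    nielsenBasis i b t = (1 : MvPolynomial (Fin n) k) ⊗ₜ[k] (extBasis k n i t.1 ⊗ₜ[k] b t.2) := by
  rw [nielsenBasis, Module.Basis.baseChange_apply, Module.Basis.tensorProduct_apply']

instance nielsenA_isScalarTower (i : ℕ) :
    IsScalarTower k (MvPolynomial (Fin n) k) (NielsenA k n M i) :=
  TensorProduct.isScalarTower_left

theorem smul_nielsenBasis (i : ℕ) {ι : Type*} (b : Module.Basis ι k M)
    (t : Set.powersetCard (Fin n) i × ι) (r : MvPolynomial (Fin n) k) :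
    r • nielsenBasis i b t = r ⊗ₜ[k] (extBasis k n i t.1 ⊗ₜ[k] b t.2) := by
  rw [nielsenBasis_apply, TensorProduct.smul_tmul', smul_eq_mul, mul_one]

/-- The total grading of `A_i(M)` is the one given by the degrees of the basis that consists of the
products of increasing monomials with homogeneous basis vectors of `M`. -/
theorem nielsenGrading_eq_stdGrading {ℳ : ℤ → Submodule k M} {ι : Type*} {b : Module.Basis ι k M}
    {deg : ι → ℤ} (hb : IsAdapted ℳ b deg) (i : ℕ) :
    nielsenGrading d ℳ i =
      stdGrading d (nielsenBasis (n := n) i b) fun t => extDeg d i t.1 + deg t.2 := by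
  refine funext fun j => le_antisymm (Submodule.span_le.2 ?_) fun f hf => ?_
  · rintro _ ⟨j₁, j₂, j₃, h, r, hr, w, hw, μ, hμ, rfl⟩
    rw [extBasis_isAdapted d i j₂] at hw
    rw [hb j₃] at hμ
    let S := stdGrading d (nielsenBasis (n := n) i b) (fun t => extDeg d i t.1 + deg t.2) j
    have h1 : ∀ T, extDeg d i T = j₂ → r ⊗ₜ[k] (extBasis k n i T ⊗ₜ[k] μ) ∈ S := by
      intro T hT
      refine (Submodule.span_le (p := S.comap (TensorProduct.mk k _ _ r ∘ₗ
        TensorProduct.mk k _ _ (extBasis k n i T)))).2 ?_ hμ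
      rintro _ ⟨t, ht, rfl⟩
      have h2 : r • nielsenBasis i b (T, t) ∈ S := by
        refine smul_basis_mem_stdGrading _ _ _ ?_ hr
        rw [← h, hT, ← ht]
        simp only
        ring
      rwa [smul_nielsenBasis] at h2
    refine (Submodule.span_le (p := S.comap (TensorProduct.mk k _ _ r ∘ₗ
        (TensorProduct.mk k _ _).flip μ))).2 ?_ hw
    rintro _ ⟨T, hT, rfl⟩
    exact h1 T hT
  · rw [← (nielsenBasis i b).linearCombination_repr f, Finsupp.linearCombination_apply, Finsupp.sum]
    refine Submodule.sum_mem _ fun t _ => ?_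
    rw [smul_nielsenBasis]
    exact tmul_mem_nielsenGrading (by ring) (hf t) ((extBasis_isAdapted d i).mem t.1) (hb.mem t.2)

/-- The basis `1 ⊗ ω` of `R ⊗ ⋀^n W`. -/
def topBasis (ω : Ext k n n) (hω : ω ≠ 0) :
    Module.Basis Unit (MvPolynomial (Fin n) k) (TopModule k n) :=
  (FiniteDimensional.basisSingleton Unit (by rw [finrank_ext, Nat.choose_self]) ω hω).baseChange
    (MvPolynomial (Fin n) k)

theorem topBasis_apply (ω : Ext k n n) (hω : ω ≠ 0) :
    topBasis ω hω () = (1 : MvPolynomial (Fin n) k) ⊗ₜ[k] ω := by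
  rw [topBasis, Module.Basis.baseChange_apply, FiniteDimensional.basisSingleton_apply]

theorem topGrading_eq_stdGrading (ω : Ext k n n) (hω : ω ≠ 0) :
    topGrading d = stdGrading d (topBasis ω hω) fun _ => ∑ l, d l := by
  refine funext fun j => le_antisymm (Submodule.span_le.2 ?_) fun f hf => ?_
  · rintro _ ⟨j₁, j₂, h, r, hr, w, hw, rfl⟩
    by_cases hj : j₂ = ∑ l, d l
    · have hfin : Module.finrank k (Ext k n n) = 1 := by rw [finrank_ext, Nat.choose_self]
      obtain ⟨c, rfl⟩ := exists_smul_eq_of_finrank_eq_one hfin hω w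
      have h2 : (c • r) • topBasis ω hω () ∈
          stdGrading d (topBasis ω hω) (fun _ => ∑ l, d l) j := by
        refine smul_basis_mem_stdGrading _ _ _ ?_ (Submodule.smul_mem _ c hr)
        rw [← h, hj]
      rwa [topBasis_apply, TensorProduct.smul_tmul', smul_eq_mul, mul_one,
        TensorProduct.smul_tmul] at h2
    · rw [extGrading_top_eq_bot hj, Submodule.mem_bot] at hw
      rw [hw, TensorProduct.tmul_zero]
      exact zero_mem _
  · rw [← (topBasis ω hω).linearCombination_repr f, Finsupp.linearCombination_apply, Finsupp.sum]
    refine Submodule.sum_mem _ fun t _ => ?_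
    rw [topBasis_apply, TensorProduct.smul_tmul', smul_eq_mul, mul_one]
    exact Submodule.subset_span ⟨_, _, sub_add_cancel _ _, _, hf t, _, mem_extGrading_top d ω, rfl⟩

theorem exists_ext_top_ne_zero (k : Type*) [Field k] (n : ℕ) : ∃ ω : Ext k n n, ω ≠ 0 := by
  have hfin : Module.finrank k (Ext k n n) = 1 := by rw [finrank_ext, Nat.choose_self]
  have : Nontrivial (Ext k n n) := Module.nontrivial_of_finrank_eq_succ hfin
  exact exists_ne 0

theorem isGradedFree_nielsen [Module.Finite k M] {ℳ : ℤ → Submodule k M}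
    (hℳ : DirectSum.IsInternal ℳ) (i : ℕ) : IsGradedFree d (nielsenGrading d ℳ i) := by
  obtain ⟨N, b, deg, hb⟩ := exists_isAdapted ℳ hℳ
  rw [nielsenGrading_eq_stdGrading hb]
  exact isGradedFree_stdGrading _ _

/-- A homogeneous basis of `A_i(M)` has a homogeneous dual basis. -/
theorem nielsenDualGrading_eq_stdGrading {ℳ : ℤ → Submodule k M} {i : ℕ}
    (hfree : IsGradedFree d (nielsenGrading d ℳ i)) (s : ℤ) {ι : Type*} [Finite ι]
    {B : Module.Basis ι (MvPolynomial (Fin n) k) (NielsenA k n M i)} {deg : ι → ℤ}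
    (hB : ∀ t, B t ∈ nielsenGrading d ℳ i (deg t)) (ω : Ext k n n) (hω : ω ≠ 0) :
    nielsenDualGrading d ℳ s i =
      stdGrading d (homBasis B (topBasis ω hω)) fun t => ∑ l, d l + s - deg t := by
  rw [← homGrading_stdGrading, ← hfree.eq_stdGrading hB, ← topGrading_eq_stdGrading]
  rfl

theorem isGradedFree_nielsenDual [Module.Finite k M] {ℳ : ℤ → Submodule k M}
    (hℳ : DirectSum.IsInternal ℳ) (s : ℤ) (i : ℕ) :
    IsGradedFree d (F := NielsenDual k n M i) (nielsenDualGrading d ℳ s i) := by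
  obtain ⟨ω, hω⟩ := exists_ext_top_ne_zero k n
  have hfree := isGradedFree_nielsen (d := d) hℳ i
  obtain ⟨N, B, hB⟩ := hfree.exists_basis
  choose deg hdeg using hB
  rw [nielsenDualGrading_eq_stdGrading hfree s hdeg ω hω]
  exact isGradedFree_stdGrading _ _

end NielsenGrading

/-! ### The exterior product is a perfect pairing -/

section WedgePairing

variable {k : Type*} [Field k] {n : ℕ}

theorem bijective_of_injective_of_finrank_eq {V V' L : Type*} [AddCommGroup V] [Module k V]
    [Module.Finite k V] [AddCommGroup V'] [Module k V'] [Module.Finite k V'] [AddCommGroup L]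
    [Module k L] [Module.Finite k L] {f : V →ₗ[k] V' →ₗ[k] L} (hf : Function.Injective f)
    (h : Module.finrank k V = Module.finrank k V') (h1 : Module.finrank k L = 1) :
    Function.Bijective f := by
  have hdim : Module.finrank k V = Module.finrank k (V' →ₗ[k] L) := by
    rw [Module.finrank_linearMap, h1, mul_one, h]
  exact ⟨hf, (LinearMap.injective_iff_surjective_of_finrank_eq_finrank hdim).1 hf⟩

/-- If `w' ∧ w = 0` for all `w'` of complementary degree, then `w = 0`: the product of `w` with the
monomial on the complement of `S` is, up to sign, the coordinate of `w` at `S`. -/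
theorem wedge_flip_injective {p q : ℕ} (h : q + p = n) :
    Function.Injective ((wedge (k := k) (n := n) h).flip) := by
  refine (injective_iff_map_eq_zero _).2 fun w hw => ?_
  refine (extBasis k n p).repr.injective (Finsupp.ext fun S => ?_)
  rw [map_zero, Finsupp.zero_apply]
  have hcard : (S : Finset (Fin n))ᶜ.card = q := by
    rw [Finset.card_compl, show (S : Finset (Fin n)).card = p from S.2, Fintype.card_fin]
    omega
  let T : Set.powersetCard (Fin n) q := ⟨(S : Finset (Fin n))ᶜ, hcard⟩
  have hdisj : Disjoint T.val S.val := disjoint_compl_left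
  let B := (Pi.basisFun k (Fin n)).ExteriorAlgebra
  have hB : ∀ {i : ℕ} (U : Set.powersetCard (Fin n) i),
      (extBasis k n i U : ExteriorAlgebra k (Fin n → k)) = B U := fun U =>
    (ExteriorAlgebra.basis_eq_coe_basis (Pi.basisFun k (Fin n)) U).symm
  have hw0 : B T * (w : ExteriorAlgebra k (Fin n → k)) = 0 := by
    have := congrArg Subtype.val (LinearMap.congr_fun hw (extBasis k n q T))
    rwa [← hB]
  have hsum : (w : ExteriorAlgebra k (Fin n → k)) =
      ∑ U, (extBasis k n p).repr w U • B U := by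
    conv_lhs => rw [← (extBasis k n p).sum_repr w]
    rw [Submodule.coe_sum]
    exact Finset.sum_congr rfl fun U _ => by rw [Submodule.coe_smul, hB]
  rw [hsum, Finset.mul_sum, Finset.sum_eq_single S] at hw0
  · rw [mul_smul_comm, ExteriorAlgebra.basis_mul_of_disjoint _ T S hdisj] at hw0
    by_contra hne
    have h1 := (smul_eq_zero.1 hw0).resolve_left hne
    rw [smul_eq_zero_iff_eq] at h1
    exact B.ne_zero _ h1
  · intro U _ hU
    rw [mul_smul_comm, ExteriorAlgebra.basis_mul_of_not_disjoint _ T U, smul_zero]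
    intro hd
    refine hU (Subtype.ext ?_)
    have hsub : U.val ⊆ S.val := by
      rw [← compl_compl S.val]
      exact Finset.subset_compl_iff_disjoint_left.2 hd
    exact Finset.eq_of_subset_of_card_le hsub (by rw [S.2, U.2])
  · exact fun hS => absurd (Finset.mem_univ _) hS

theorem wedge_flip_bijective {p q : ℕ} (h : q + p = n) :
    Function.Bijective ((wedge (k := k) (n := n) h).flip) :=
  bijective_of_injective_of_finrank_eq (wedge_flip_injective h) (by
    rw [finrank_ext, finrank_ext, Nat.choose_symm_of_eq_add (by omega : n = p + q)])
    (by rw [finrank_ext, Nat.choose_self])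

/-- Since `w' ∧ w` lies in `⋀^(n+1) W = 0`, the Leibniz rule moves a contraction from one factor to
the other. -/
theorem wedge_contract (l : Fin n) {p q : ℕ} (h : q + (p + 1) = n) (h' : (q + 1) + p = n)
    (w' : Ext k n (q + 1)) (w : Ext k n (p + 1)) :
    wedge h' w' (contract l p w) = (-1 : k) ^ q • wedge h (contract l q w') w := by
  have hz : (w' : ExteriorAlgebra k (Fin n → k)) * w = 0 := by
    have h0 : Module.finrank k (Ext k n (n + 1)) = 0 := by
      rw [finrank_ext, Nat.choose_succ_self]
    have : Subsingleton (Ext k n (n + 1)) := Module.finrank_zero_iff.1 h0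
    exact congrArg Subtype.val
      (Subsingleton.elim (wedge (show (q + 1) + (p + 1) = n + 1 by omega) w' w) 0)
  have hl := totalContract_mul l w'.2 (w : ExteriorAlgebra k (Fin n → k))
  rw [hz, map_zero, pow_succ, mul_neg_one, neg_smul, ← sub_eq_add_neg] at hl
  refine Subtype.ext ?_
  change (w' : ExteriorAlgebra k (Fin n → k)) *
      totalContract l (w : ExteriorAlgebra k (Fin n → k)) =
    (-1 : k) ^ q • (totalContract l (w' : ExteriorAlgebra k (Fin n → k)) *
      (w : ExteriorAlgebra k (Fin n → k)))
  rw [sub_eq_zero.1 hl.symm, smul_smul, ← mul_pow, neg_one_mul, neg_neg, one_pow, one_smul]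

end WedgePairing

/-! ### The isomorphisms `β` -/

section Beta

variable {k : Type*} [Field k] {n : ℕ} {M : Type*} [AddCommGroup M] [Module k M]
  [Module (MvPolynomial (Fin n) k) M] [IsScalarTower k (MvPolynomial (Fin n) k) M]

/-- A vector space that is isomorphic to its dual is finite-dimensional, since the dual of an
infinite-dimensional space has strictly larger dimension. -/
theorem finite_of_dual_equiv.{u, v} {k : Type u} [Field k] {M : Type v} [AddCommGroup M]
    [Module k M] (e : M ≃ₗ[k] Module.Dual k M) : Module.Finite k M := by
  by_contra hinf
  have h1 : Cardinal.aleph0 ≤ Module.rank k M := by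
    rw [← not_lt]
    exact fun h => hinf (Module.rank_lt_aleph0_iff.1 h)
  have h2 := lift_rank_lt_rank_dual h1
  have h3 := e.lift_rank_eq
  rw [Cardinal.lift_umax.{v, u}, Cardinal.lift_id'.{v, u}] at h3
  exact h2.ne h3

/-- For finite-dimensional spaces, the tensor product of two perfect pairings `f` and `g` is perfect
after base change. -/
theorem liftBaseChange_map₂_bijective {A V V' L : Type*} [CommRing A] [Algebra k A]
    [Module.Flat k A]
    [AddCommGroup V] [Module k V] [AddCommGroup V'] [Module k V'] [Module.Finite k V']
    [AddCommGroup L] [Module k L] {M : Type*} [AddCommGroup M] [Module k M] [Module.Finite k M]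
    {f : V →ₗ[k] V' →ₗ[k] L} (hf : Function.Bijective f)
    {g : M →ₗ[k] M →ₗ[k] k} (hg : Function.Bijective g) :
    Function.Bijective (LinearMap.liftBaseChange A
      (LinearMap.baseChangeHom k A (V' ⊗[k] M) L ∘ₗ
        (TensorProduct.map₂ f g).compr₂ (TensorProduct.rid k L).toLinearMap)) := by
  let e : V ⊗[k] M ≃ₗ[k] (V' ⊗[k] M →ₗ[k] L) :=
    TensorProduct.congr (LinearEquiv.ofBijective f hf) (LinearEquiv.ofBijective g hg) ≪≫ₗ
      homTensorHomEquiv k V' M L k ≪≫ₗ LinearEquiv.congrRight (TensorProduct.rid k L)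
  have := Module.finitePresentation_of_finite k (V' ⊗[k] M)
  have hbc := Module.FinitePresentation.isBaseChange_map k (V' ⊗[k] M) L A
  let E := LinearEquiv.baseChange k A _ _ e ≪≫ₗ hbc.equiv
  have hE : (LinearMap.liftBaseChange A (LinearMap.baseChangeHom k A (V' ⊗[k] M) L ∘ₗ
      (TensorProduct.map₂ f g).compr₂ (TensorProduct.rid k L).toLinearMap)) = E.toLinearMap := by
    refine TensorProduct.AlgebraTensorModule.ext fun a x => ?_
    rw [LinearMap.liftBaseChange_tmul, LinearEquiv.coe_coe, LinearEquiv.trans_apply,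
      LinearEquiv.baseChange_tmul, hbc.equiv_tmul]
    have : e x = (TensorProduct.map₂ f g).compr₂ (TensorProduct.rid k L).toLinearMap x := by
      induction x using TensorProduct.induction_on with
      | zero => rw [map_zero, map_zero]
      | add x y hx hy => rw [map_add, map_add, hx, hy]
      | tmul v μ =>
        ext
        simp [e, LinearEquiv.congrRight]
    rw [this]
    rfl
  rw [hE]
  exact E.bijective

/-- `β` is the base change to `R` of the tensor product of the pairings given by the exterior
product and by `τ`. -/
theorem beta_bijective [Module.Finite k M] (τ : M ≃ₗ[MvPolynomial (Fin n) k] Module.Dual k M)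
    {p q : ℕ} (h : q + p = n) : Function.Bijective (beta τ h) := by
  have := liftBaseChange_map₂_bijective (A := MvPolynomial (Fin n) k) (V := Ext k n p)
    (V' := Ext k n q) (L := Ext k n n) (wedge_flip_bijective h)
    (g := τ.toLinearMap.restrictScalars k) τ.bijective
  exact this

theorem tmul_mem_topGrading {d : Fin n → ℤ} {j₁ j₂ j : ℤ} (h : j₁ + j₂ = j)
    {r : MvPolynomial (Fin n) k} {w : Ext k n n}
    (hr : r ∈ MvPolynomial.weightedHomogeneousSubmodule k d j₁) (hw : w ∈ extGrading k d n j₂) :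
    r ⊗ₜ[k] w ∈ topGrading d j :=
  Submodule.subset_span ⟨j₁, j₂, h, r, hr, w, hw, rfl⟩

theorem beta_graded {d : Fin n → ℤ} {ℳ : ℤ → Submodule k M} {s : ℤ} {ε : ℤˣ}
    {τ : M ≃ₗ[MvPolynomial (Fin n) k] Module.Dual k M} (hτ : IsGorensteinIso ℳ s ε τ)
    {p q : ℕ} (h : q + p = n) :
    IsGradedMap (nielsenGrading d ℳ p) (nielsenDualGrading d ℳ s q) (beta τ h) := by
  intro j a ha
  refine nielsenGrading_le (S := (nielsenDualGrading d ℳ s q j).comap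
    ((beta τ h).restrictScalars k)) ?_ ha
  intro j₁ j₂ j₃ hj r hr w hw μ hμ e a' ha'
  refine nielsenGrading_le (S := (topGrading d (e + (j - s))).comap
    ((beta τ h (r ⊗ₜ[k] (w ⊗ₜ[k] μ))).restrictScalars k)) ?_ ha'
  intro j₁' j₂' j₃' hj' r' hr' w' hw' μ' hμ'
  rw [Submodule.mem_comap, LinearMap.restrictScalars_apply, beta_tmul]
  by_cases hdeg : j₃' = -(j₃ - s)
  -- `τ` pairs `ℳ j₃` nontrivially only with `ℳ (s - j₃)`.
  · refine tmul_mem_topGrading (j₁ := j₁' + j₁) (j₂ := j₂' + j₂) ?_ (mul_mem_weighted rfl hr' hr)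
      (Submodule.smul_mem _ _ (wedge_mem_extGrading h rfl hw' hw))
    rw [← hj, ← hj', hdeg]
    ring
  · rw [hτ.graded j₃ μ hμ j₃' hdeg μ' hμ', zero_smul, TensorProduct.tmul_zero]
    exact zero_mem _

theorem tau_smul_apply (τ : M ≃ₗ[MvPolynomial (Fin n) k] Module.Dual k M)
    (r : MvPolynomial (Fin n) k) (μ μ' : M) : τ (r • μ) μ' = τ μ (r • μ') := by
  rw [map_smul, dual_smul_apply]

theorem tau_symm {ℳ : ℤ → Submodule k M} {s : ℤ} {ε : ℤˣ}
    {τ : M ≃ₗ[MvPolynomial (Fin n) k] Module.Dual k M} (hτ : IsGorensteinIso ℳ s ε τ) (μ μ' : M) :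
    τ μ' μ = ε • τ μ μ' := by
  have := LinearMap.congr_fun (LinearMap.congr_fun hτ.dual_eq μ) μ'
  exact this

theorem neg_one_units_pow_smul {E : Type*} [AddCommGroup E] [Module k E] (q : ℕ) (x : E) :
    (-1 : ℤˣ) ^ q • x = (-1 : k) ^ q • x := by
  rcases neg_one_pow_eq_or ℤˣ q with h | h
  · rw [h, one_smul, show (-1 : k) ^ q = 1 by simpa using congrArg (fun u : ℤˣ => ((u : ℤ) : k)) h,
      one_smul]
  · rw [h, Units.neg_smul, one_smul,
      show (-1 : k) ^ q = -1 by simpa using congrArg (fun u : ℤˣ => ((u : ℤ) : k)) h, neg_smul,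
      one_smul]

/-- The terms with `x_l` acting on `R` are matched by `wedge_contract`; those with `x_l` acting on
`M` also use that `τ` is linear over `R`. -/
theorem beta_phi_apply (τ : M ≃ₗ[MvPolynomial (Fin n) k] Module.Dual k M) {p q : ℕ}
    (h : q + (p + 1) = n) (h' : (q + 1) + p = n) (a : NielsenA k n M (p + 1))
    (b : NielsenA k n M (q + 1)) :
    beta τ h' (phi M p a) b = (-1 : k) ^ q • beta τ h a (phi M q b) := by
  induction a using tensor_induction with
  | h0 => simp only [map_zero, LinearMap.zero_apply, smul_zero]
  | hadd a a' ha ha' => rw [map_add, map_add, map_add, LinearMap.add_apply, LinearMap.add_apply,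
      ha, ha', smul_add]
  | ht r w μ =>
    induction b using tensor_induction with
    | h0 => rw [map_zero, map_zero, map_zero, smul_zero]
    | hadd b b' hb hb' => rw [map_add, map_add, map_add, hb, hb', smul_add]
    | ht r' w' μ' =>
      rw [phi_tmul, phi_tmul]
      simp only [map_sub, map_sum, LinearMap.sub_apply, LinearMap.sum_apply, beta_tmul, smul_sub,
        Finset.smul_sum, wedge_contract _ h h', tau_smul_apply, TensorProduct.tmul_smul,
        smul_comm ((-1 : k) ^ q)]
      simp only [mul_left_comm r', mul_assoc]

theorem beta_comp_phi (τ : M ≃ₗ[MvPolynomial (Fin n) k] Module.Dual k M) {p q : ℕ}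
    (h : q + (p + 1) = n) (h' : (q + 1) + p = n) :
    beta τ h' ∘ₗ phi M p = (-1 : ℤˣ) ^ q • (phiDual M q ∘ₗ beta τ h) := by
  refine LinearMap.ext fun a => LinearMap.ext fun b => ?_
  refine (beta_phi_apply τ h h' a b).trans ?_
  exact (neg_one_units_pow_smul q (beta τ h a (phi M q b))).symm

/-- Up to the sign `ε`, the two isomorphisms `β` in complementary degrees are adjoint to each other
if one of the degrees is even. -/
theorem beta_symm {ℳ : ℤ → Submodule k M} {s : ℤ} {ε : ℤˣ}
    {τ : M ≃ₗ[MvPolynomial (Fin n) k] Module.Dual k M} (hτ : IsGorensteinIso ℳ s ε τ) {p q : ℕ}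
    (h : q + p = n) (h' : p + q = n) (hpq : Even (p * q)) (a : NielsenA k n M p)
    (b : NielsenA k n M q) : beta τ h' b a = ε • beta τ h a b := by
  induction a using tensor_induction with
  | h0 => simp only [map_zero, LinearMap.zero_apply, smul_zero]
  | hadd a a' ha ha' => rw [map_add, map_add, LinearMap.add_apply, ha, ha', smul_add]
  | ht r w μ =>
    induction b using tensor_induction with
    | h0 => simp only [map_zero, LinearMap.zero_apply, smul_zero]
    | hadd b b' hb hb' => rw [map_add, map_add, LinearMap.add_apply, hb, hb', smul_add]
    | ht r' w' μ' =>
      have hw : wedge h' w w' = wedge h w' w := by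
        refine Subtype.ext ((mul_comm_ext w'.2 w.2).trans ?_)
        rw [mul_comm q p, hpq.neg_one_pow, one_smul]
        rfl
      rw [beta_tmul, beta_tmul, hw, mul_comm r r', tau_symm hτ μ μ']
      rcases Int.units_eq_one_or ε with rfl | rfl
      · rw [one_smul, one_smul]
      · rw [Units.neg_smul, Units.neg_smul, one_smul, one_smul, ← neg_one_mul (τ μ μ'),
          mul_smul, TensorProduct.tmul_smul]
        exact neg_one_smul k ((r' * r) ⊗ₜ[k] (τ μ μ' • wedge h w' w) : TopModule k n)

end Beta

/-! ### Degrees of the differentials -/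

section Graded

variable {k : Type*} [Field k] {n : ℕ} {d : Fin n → ℤ} {M : Type*} [AddCommGroup M] [Module k M]
  [Module (MvPolynomial (Fin n) k) M] {ℳ : ℤ → Submodule k M}

theorem smul_mem_graded [SetLike.GradedSMul (MvPolynomial.weightedHomogeneousSubmodule k d) ℳ]
    {i j l : ℤ} (h : i + j = l) {r : MvPolynomial (Fin n) k} {μ : M}
    (hr : r ∈ MvPolynomial.weightedHomogeneousSubmodule k d i) (hμ : μ ∈ ℳ j) : r • μ ∈ ℳ l :=
  h ▸ SetLike.GradedSMul.smul_mem hr hμ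

variable [IsScalarTower k (MvPolynomial (Fin n) k) M]

theorem phi_graded [SetLike.GradedSMul (MvPolynomial.weightedHomogeneousSubmodule k d) ℳ] (i : ℕ) :
    IsGradedMap (nielsenGrading d ℳ (i + 1)) (nielsenGrading d ℳ i) (phi M i) := by
  intro j a ha
  refine nielsenGrading_le (S := (nielsenGrading d ℳ i j).comap
    ((phi M i).restrictScalars k)) ?_ ha
  intro j₁ j₂ j₃ hj r hr w hw μ hμ
  have hX : ∀ l, (MvPolynomial.X l : MvPolynomial (Fin n) k) ∈
      MvPolynomial.weightedHomogeneousSubmodule k d (d l) := fun l =>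
    MvPolynomial.isWeightedHomogeneous_X k d l
  rw [Submodule.mem_comap, LinearMap.restrictScalars_apply, phi_tmul]
  refine sub_mem (Submodule.sum_mem _ fun l _ => ?_) (Submodule.sum_mem _ fun l _ => ?_)
  · refine tmul_mem_nielsenGrading (j₁ := d l + j₁) (j₂ := j₂ - d l) (j₃ := j₃) ?_
      (mul_mem_weighted rfl (hX l) hr) (contract_mem_extGrading l (by ring) hw) hμ
    rw [← hj]
    ring
  · refine tmul_mem_nielsenGrading (j₁ := j₁) (j₂ := j₂ - d l) (j₃ := d l + j₃) ?_
      hr (contract_mem_extGrading l (by ring) hw) (smul_mem_graded rfl (hX l) hμ)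
    rw [← hj]
    ring

theorem augmentation_graded
    [SetLike.GradedSMul (MvPolynomial.weightedHomogeneousSubmodule k d) ℳ] :
    IsGradedMap (nielsenGrading d ℳ 0) ℳ (augmentation k n M) := by
  intro j a ha
  refine nielsenGrading_le (S := (ℳ j).comap ((augmentation k n M).restrictScalars k)) ?_ ha
  intro j₁ j₂ j₃ hj r hr w hw μ hμ
  refine extGrading_le (S := (ℳ j).comap ((augmentation k n M).restrictScalars k ∘ₗ
    TensorProduct.mk k _ _ r ∘ₗ (TensorProduct.mk k _ _).flip μ)) (fun l hl => ?_) hw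
  -- `⋀^0 W` is concentrated in degree `0`.
  rw [Fin.sum_univ_zero] at hl
  change augmentation k n M (r ⊗ₜ[k] (extMonomial k l ⊗ₜ[k] μ)) ∈ ℳ j
  rw [augmentation_tmul]
  refine smul_mem_graded ?_ hr (Submodule.smul_mem _ _ hμ)
  rw [← hj, ← hl, add_zero]

theorem phiDual_graded [SetLike.GradedSMul (MvPolynomial.weightedHomogeneousSubmodule k d) ℳ]
    (s : ℤ) (i : ℕ) :
    IsGradedMap (F := NielsenDual k n M i) (G := NielsenDual k n M (i + 1))
      (nielsenDualGrading d ℳ s i) (nielsenDualGrading d ℳ s (i + 1)) (phiDual M i) :=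
  fun _ _ hf e a ha => hf e _ (phi_graded i e a ha)

end Graded

/-! ### Exactness of the dual complex -/

section DualExact

section Square

variable {R A₁ A₀ D₁ D₀ : Type*} [CommRing R] [AddCommGroup A₁] [Module R A₁] [AddCommGroup A₀]
  [Module R A₀] [AddCommGroup D₁] [Module R D₁] [AddCommGroup D₀] [Module R D₀]
  {φ : A₁ →ₗ[R] A₀} {ψ : D₁ →ₗ[R] D₀} {β₁ : A₁ →ₗ[R] D₁} {β₀ : A₀ →ₗ[R] D₀} {u : ℤˣ}

/-- In a square that commutes up to the sign `u`, the sign can be moved to the other side. -/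
theorem square_apply (h : β₀ ∘ₗ φ = u • (ψ ∘ₗ β₁)) (a : A₁) :
    ψ (β₁ a) = u • β₀ (φ a) := by
  have := LinearMap.congr_fun h a
  rw [LinearMap.comp_apply] at this
  rw [this, LinearMap.smul_apply, smul_smul, Int.units_mul_self, one_smul, LinearMap.comp_apply]

theorem ker_of_square (h : β₀ ∘ₗ φ = u • (ψ ∘ₗ β₁)) (h₁ : Function.Bijective β₁)
    (h₀ : Function.Bijective β₀) : LinearMap.ker ψ = (LinearMap.ker φ).map β₁ := by
  ext f
  obtain ⟨a, rfl⟩ := h₁.2 f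
  rw [LinearMap.mem_ker, square_apply h, smul_eq_zero_iff_eq, map_eq_zero_iff β₀ h₀.1,
    Submodule.mem_map]
  constructor
  · exact fun ha => ⟨a, ha, rfl⟩
  · rintro ⟨a', ha', heq⟩
    rwa [← h₁.1 heq]

theorem range_of_square (h : β₀ ∘ₗ φ = u • (ψ ∘ₗ β₁)) (h₁ : Function.Bijective β₁) :
    LinearMap.range ψ = (LinearMap.range φ).map β₀ := by
  ext f
  constructor
  · rintro ⟨x, rfl⟩
    obtain ⟨a, rfl⟩ := h₁.2 x
    rw [square_apply h]
    rcases Int.units_eq_one_or u with hu | hu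
    · rw [hu, one_smul]
      exact Submodule.mem_map_of_mem ⟨a, rfl⟩
    · rw [hu, Units.neg_smul, one_smul]
      exact neg_mem (Submodule.mem_map_of_mem ⟨a, rfl⟩)
  · rintro ⟨_, ⟨a, rfl⟩, rfl⟩
    have := LinearMap.congr_fun h a
    rw [LinearMap.comp_apply] at this
    rw [this, LinearMap.smul_apply]
    rcases Int.units_eq_one_or u with hu | hu
    · rw [hu, one_smul]
      exact ⟨_, rfl⟩
    · rw [hu, Units.neg_smul, one_smul]
      exact neg_mem ⟨_, rfl⟩

end Square

variable {k : Type*} [Field k] {n : ℕ} {M : Type*} [AddCommGroup M] [Module k M]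

/-- `A_i(M) = 0` for `i > n`. -/
theorem subsingleton_nielsen (k : Type*) [Field k] {n : ℕ} (M : Type*) [AddCommGroup M] [Module k M]
    {i : ℕ} (hi : n < i) : Subsingleton (NielsenA k n M i) := by
  have h0 : Module.finrank k (Ext k n i) = 0 := by rw [finrank_ext, Nat.choose_eq_zero_of_lt hi]
  have : Subsingleton (Ext k n i) := Module.finrank_zero_iff.1 h0
  refine subsingleton_of_forall_eq 0 fun a => ?_
  induction a using tensor_induction with
  | h0 => rfl
  | ht r w μ => rw [Subsingleton.elim w 0, TensorProduct.zero_tmul, TensorProduct.tmul_zero]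
  | hadd a b ha hb => rw [ha, hb, add_zero]

variable [Module (MvPolynomial (Fin n) k) M] [IsScalarTower k (MvPolynomial (Fin n) k) M]
  [Module.Finite k M] (τ : M ≃ₗ[MvPolynomial (Fin n) k] Module.Dual k M)

/-- Under `β`, the kernels of the differentials of the Nielsen complex become the images of the
differentials of the dual complex. -/
theorem map_beta_ker_phi {p q : ℕ} (h : q + (p + 1) = n) :
    (LinearMap.ker (phi M p)).map (beta τ h) = rangeIn (G := NielsenDual k n M) (phiDual M) q := by
  rw [← range_phi_succ]
  match q, h with
  | 0, h =>
    have := subsingleton_nielsen k M (show n < p + 2 by omega)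
    rw [LinearMap.range_eq_bot.2 (LinearMap.ext fun a => by
      rw [Subsingleton.elim a 0, map_zero, map_zero]), Submodule.map_bot]
    rfl
  | q + 1, h =>
    have hq : q + (p + 1 + 1) = n := by omega
    have h₁ : Function.Bijective (beta τ hq) := beta_bijective τ hq
    have hsq := beta_comp_phi τ hq h
    exact (range_of_square (R := MvPolynomial (Fin n) k) (A₁ := NielsenA k n M (p + 1 + 1))
      (A₀ := NielsenA k n M (p + 1)) (D₁ := NielsenDual k n M q)
      (D₀ := NielsenDual k n M (q + 1)) hsq h₁).symm

/-- Exactness of the dual complex. -/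
theorem ker_phiDual (τ : M ≃ₗ[MvPolynomial (Fin n) k] Module.Dual k M) {q : ℕ} (hq : q < n) :
    LinearMap.ker (phiDual M q) = rangeIn (G := NielsenDual k n M) (phiDual M) q := by
  obtain ⟨p, hp⟩ : ∃ p, q + (p + 1) = n := ⟨n - q - 1, by omega⟩
  rw [← map_beta_ker_phi τ hp]
  have hp' : (q + 1) + p = n := by omega
  have h₁ : Function.Bijective (beta τ hp) := beta_bijective τ hp
  have h₀ : Function.Bijective (beta τ hp') := beta_bijective τ hp'
  have hsq := beta_comp_phi τ hp hp'
  exact ker_of_square (R := MvPolynomial (Fin n) k) (A₁ := NielsenA k n M (p + 1))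
    (A₀ := NielsenA k n M p) (D₁ := NielsenDual k n M q) (D₀ := NielsenDual k n M (q + 1)) hsq h₁ h₀

end DualExact

/-! ### The middle map -/

section Middle

variable {k : Type*} [Field k] {n m : ℕ} {M : Type*} [AddCommGroup M] [Module k M]
  [Module (MvPolynomial (Fin n) k) M] [IsScalarTower k (MvPolynomial (Fin n) k) M]
  {τ : M ≃ₗ[MvPolynomial (Fin n) k] Module.Dual k M} (hn : m + (m + 1) = n)
  (hβ : Function.Bijective (beta τ hn))

theorem middleMap_beta (a : NielsenA k n M (m + 1)) :
    middleMap τ hn hβ (beta τ hn a) = phi M m a :=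
  congrArg (phi M m) ((LinearEquiv.ofBijective (beta τ hn) hβ).symm_apply_apply a)

/-- `β_{m+1}` is a graded isomorphism, so it reflects degrees. -/
theorem mem_nielsenGrading_of_beta_mem [Module.Finite k M] {d : Fin n → ℤ}
    {ℳ : ℤ → Submodule k M} (hℳ : DirectSum.IsInternal ℳ) {s : ℤ} {ε : ℤˣ}
    (hτ : IsGorensteinIso ℳ s ε τ) (hinj : Function.Injective (beta τ hn)) (j : ℤ)
    (a : NielsenA k n M (m + 1)) (ha : beta τ hn a ∈ nielsenDualGrading d ℳ s m j) :
    a ∈ nielsenGrading d ℳ (m + 1) j := by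
  have h1 := (isGradedFree_nielsen (d := d) hℳ (m + 1)).isInternal
  have h2 := (isGradedFree_nielsenDual (d := d) hℳ s m).isInternal
  have h3 := beta_graded (d := d) hτ hn
  refine mem_of_map_mem (E := NielsenA k n M (m + 1)) (E' := NielsenDual k n M m)
    (S := MvPolynomial (Fin n) k) (𝒜 := nielsenGrading d ℳ (m + 1))
    (ℬ := nielsenDualGrading d ℳ s m) (f := beta τ hn) ?_ ?_ ?_ ?_ ?_
  · exact h1
  · exact h2
  · exact hinj
  · exact h3
  · exact ha

theorem middleMap_graded [Module.Finite k M] {d : Fin n → ℤ} {ℳ : ℤ → Submodule k M}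
    (hℳ : DirectSum.IsInternal ℳ)
    [SetLike.GradedSMul (MvPolynomial.weightedHomogeneousSubmodule k d) ℳ] {s : ℤ} {ε : ℤˣ}
    (hτ : IsGorensteinIso ℳ s ε τ) :
    IsGradedMap (F := NielsenDual k n M m) (G := NielsenA k n M m)
      (nielsenDualGrading d ℳ s m) (nielsenGrading d ℳ m) (middleMap τ hn hβ) := by
  intro j f hf
  obtain ⟨a, rfl⟩ := hβ.2 f
  rw [middleMap_beta]
  exact phi_graded m j a (mem_nielsenGrading_of_beta_mem hn hℳ hτ hβ.1 j a hf)

theorem range_middleMap : LinearMap.range (middleMap τ hn hβ) = LinearMap.range (phi M m) := by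
  ext x
  constructor
  · rintro ⟨f, rfl⟩
    obtain ⟨a, rfl⟩ := hβ.2 f
    exact ⟨a, (middleMap_beta hn hβ a).symm⟩
  · rintro ⟨a, rfl⟩
    exact ⟨_, middleMap_beta hn hβ a⟩

theorem ker_middleMap :
    LinearMap.ker (middleMap τ hn hβ) = (LinearMap.ker (phi M m)).map (beta τ hn) := by
  ext f
  obtain ⟨a, rfl⟩ := hβ.2 f
  rw [LinearMap.mem_ker, middleMap_beta, Submodule.mem_map]
  constructor
  · exact fun ha => ⟨a, ha, rfl⟩
  · rintro ⟨a', ha', heq⟩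
    rwa [← hβ.1 heq]

/-- The form `(f, g) ↦ f (middleMap g)` on `A_m(M)^∨` is symmetric up to the sign `(-1)^m ε`. -/
theorem middleMap_symm {ℳ : ℤ → Submodule k M} {s : ℤ} {ε : ℤˣ} (hτ : IsGorensteinIso ℳ s ε τ)
    (f g : NielsenDual k n M m) :
    f (middleMap τ hn hβ g) = ((-1 : ℤˣ) ^ m * ε) • g (middleMap τ hn hβ f) := by
  obtain ⟨a, rfl⟩ := hβ.2 f
  obtain ⟨b, rfl⟩ := hβ.2 g
  rw [middleMap_beta, middleMap_beta]
  have hn' : (m + 1) + m = n := by omega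
  have h1 : beta τ hn' (phi M m a) b = (-1 : ℤˣ) ^ m • beta τ hn a (phi M m b) :=
    LinearMap.congr_fun (LinearMap.congr_fun (beta_comp_phi τ hn hn') a) b
  -- `m (m + 1)` is even, so exchanging the arguments of `β` only introduces `ε`.
  have h2 := beta_symm hτ hn hn' (mul_comm m (m + 1) ▸ Nat.even_mul_succ_self m) b (phi M m a)
  rw [h2] at h1
  rw [mul_smul, h1, smul_smul, Int.units_mul_self, one_smul]

theorem toMatrix_middleMap {ℳ : ℤ → Submodule k M} {s : ℤ} {ε : ℤˣ} (hτ : IsGorensteinIso ℳ s ε τ)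
    {ι : Type*} [Fintype ι] [DecidableEq ι]
    (B : Module.Basis ι (MvPolynomial (Fin n) k) (NielsenA k n M m))
    (c : Module.Basis Unit (MvPolynomial (Fin n) k) (TopModule k n)) :
    LinearMap.toMatrix (homBasis B c) B (middleMap τ hn hβ) =
      ((-1 : ℤˣ) ^ m * ε) •
        (LinearMap.toMatrix (homBasis B c) B (middleMap τ hn hβ)).transpose := by
  ext1 i j
  have h := middleMap_symm hn hβ hτ (homBasis B c i) (homBasis B c j)
  rw [homBasis_apply, homBasis_apply] at h
  have h' := congrArg (fun x => c.repr x ()) h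
  rw [Matrix.smul_apply, Matrix.transpose_apply, LinearMap.toMatrix_apply, LinearMap.toMatrix_apply]
  rcases Int.units_eq_one_or ((-1 : ℤˣ) ^ m * ε) with hu | hu
  · simpa [hu] using h'
  · simpa [hu] using h'

end Middle

end

end NielsenSelfdual

theorem mainTheorem1 {k : Type*} [Field k] {n m : ℕ} (hn : m + (m + 1) = n)
    (d : Fin n → ℤ) (hd : ∀ l, 0 < d l)
    {M : Type*} [AddCommGroup M] [Module k M] [Module (MvPolynomial (Fin n) k) M]
    [IsScalarTower k (MvPolynomial (Fin n) k) M]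
    (hfin : IsFiniteLength (MvPolynomial (Fin n) k) M)
    (ℳ : ℤ → Submodule k M) [DirectSum.Decomposition ℳ]
    [SetLike.GradedSMul (MvPolynomial.weightedHomogeneousSubmodule k d) ℳ]
    (s : ℤ) (ε : ℤˣ) (τ : M ≃ₗ[MvPolynomial (Fin n) k] Module.Dual k M)
    (hτ : NielsenSelfdual.IsGorensteinIso ℳ s ε τ) :
    -- the Nielsen complex is a graded free resolution of `M`
    NielsenSelfdual.IsGradedFreeResolution d
      (NielsenSelfdual.nielsenGrading d ℳ) ℳ (NielsenSelfdual.phi M)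
      (NielsenSelfdual.augmentation k n M) ∧
    -- the maps `β_p` are graded isomorphisms, compatible with the differentials up to sign
    (∀ (p q : ℕ) (h : q + p = n),
      Function.Bijective (NielsenSelfdual.beta τ h) ∧
      NielsenSelfdual.IsGradedMap (NielsenSelfdual.nielsenGrading d ℳ p)
        (NielsenSelfdual.nielsenDualGrading d ℳ s q) (NielsenSelfdual.beta τ h)) ∧
    (∀ (p q : ℕ) (h : q + (p + 1) = n) (h' : (q + 1) + p = n),
      NielsenSelfdual.beta τ h' ∘ₗ NielsenSelfdual.phi M p =
        (-1 : ℤˣ) ^ q • (NielsenSelfdual.phiDual M q ∘ₗ NielsenSelfdual.beta τ h)) ∧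
    ∃ hβ : Function.Bijective (NielsenSelfdual.beta τ hn),
      -- the selfdual complex `K(M)` is a graded free resolution of `M`
      NielsenSelfdual.IsSplicedResolution d (F := NielsenSelfdual.NielsenA k n M)
        (G := NielsenSelfdual.NielsenDual k n M) m
        (NielsenSelfdual.nielsenGrading d ℳ) (NielsenSelfdual.nielsenDualGrading d ℳ s) ℳ
        (NielsenSelfdual.phiDual M) (NielsenSelfdual.middleMap τ hn hβ)
        (NielsenSelfdual.phi M) (NielsenSelfdual.augmentation k n M) ∧
      -- every homogeneous basis `B` of `A_m(M)` has a homogeneous dual basis `B'`, and the matrix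
      -- of the middle map with respect to `B'` and `B` is symmetric or skew
      ∀ (ω : NielsenSelfdual.Ext k n n), ω ≠ 0 →
      ∀ {ι : Type*} [Fintype ι] [DecidableEq ι]
        (B : Module.Basis ι (MvPolynomial (Fin n) k) (NielsenSelfdual.NielsenA k n M m))
        (deg : ι → ℤ), (∀ i, B i ∈ NielsenSelfdual.nielsenGrading d ℳ m (deg i)) →
      ∃ B' : Module.Basis ι (MvPolynomial (Fin n) k) (NielsenSelfdual.NielsenDual k n M m),
        (∀ i j, B' i (B j) = if i = j then (1 : MvPolynomial (Fin n) k) ⊗ₜ[k] ω else 0) ∧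
        (∀ i, B' i ∈ NielsenSelfdual.nielsenDualGrading d ℳ s m (∑ l, d l + s - deg i)) ∧
        LinearMap.toMatrix B' B (NielsenSelfdual.middleMap τ hn hβ) =
          ((-1 : ℤˣ) ^ m * ε) •
            (LinearMap.toMatrix B' B (NielsenSelfdual.middleMap τ hn hβ)).transpose := by
  have hM : Module.Finite k M := NielsenSelfdual.finite_of_dual_equiv (τ.restrictScalars k)
  have hℳ : DirectSum.IsInternal ℳ := DirectSum.Decomposition.isInternal ℳ
  have hfree : ∀ i, NielsenSelfdual.IsGradedFree d (NielsenSelfdual.nielsenGrading d ℳ i) :=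
    NielsenSelfdual.isGradedFree_nielsen hℳ
  have hfree' : ∀ i, NielsenSelfdual.IsGradedFree d (F := NielsenSelfdual.NielsenDual k n M i)
      (NielsenSelfdual.nielsenDualGrading d ℳ s i) :=
    NielsenSelfdual.isGradedFree_nielsenDual hℳ s
  have hβ : ∀ (p q : ℕ) (h : q + p = n), Function.Bijective (NielsenSelfdual.beta τ h) :=
    fun p q h => NielsenSelfdual.beta_bijective τ h
  refine ⟨⟨hfree, NielsenSelfdual.phi_graded, NielsenSelfdual.augmentation_graded,
    NielsenSelfdual.range_phi_eq_kerOut, NielsenSelfdual.augmentation_surjective⟩,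
    fun p q h => ⟨hβ p q h, NielsenSelfdual.beta_graded hτ h⟩,
    fun p q h h' => NielsenSelfdual.beta_comp_phi τ h h', hβ _ _ hn, ⟨fun i _ => hfree i,
      fun i _ => hfree' i, fun i _ => NielsenSelfdual.phi_graded i,
      fun i _ => NielsenSelfdual.phiDual_graded s i,
      NielsenSelfdual.middleMap_graded hn (hβ _ _ hn) hℳ hτ, NielsenSelfdual.augmentation_graded,
      fun i hi => NielsenSelfdual.ker_phiDual τ (by omega), ?_, ?_,
      fun i _ => NielsenSelfdual.range_phi_eq_kerOut i,
      NielsenSelfdual.augmentation_surjective⟩, ?_⟩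
  · rw [NielsenSelfdual.ker_middleMap]
    exact NielsenSelfdual.map_beta_ker_phi τ hn
  · rw [NielsenSelfdual.range_middleMap]
    exact NielsenSelfdual.range_phi_eq_kerOut m
  · intro ω hω ι _ _ B deg hB
    refine ⟨NielsenSelfdual.homBasis B (NielsenSelfdual.topBasis ω hω), fun i j => ?_,
      fun i => ?_, NielsenSelfdual.toMatrix_middleMap hn (hβ _ _ hn) hτ B _⟩
    · rw [NielsenSelfdual.homBasis_apply, B.repr_self, NielsenSelfdual.topBasis_apply]
      by_cases hij : i = j
      · rw [if_pos hij, hij, Finsupp.single_eq_same, one_smul]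
      · rw [if_neg hij, Finsupp.single_eq_of_ne hij, zero_smul]
    · rw [NielsenSelfdual.nielsenDualGrading_eq_stdGrading (hfree m) s hB ω hω]
      exact NielsenSelfdual.basis_mem_stdGrading _ _ i
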